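/- **Theorem (Sym formula for dual maximal surfaces).** *Setting.* $\mathrm{Nil}_1^3$ is $\mathbb R^3$ with the multiplication $(x_1,x_2,x_3)\cdot(\tilde x_1,\tilde x_2,\tilde x_3)=(x_1+\tilde x_1,\,x_2+\tilde x_2,\,x_3+\tilde x_3+\tfrac12(x_1\tilde x_2-\tilde x_1x_2))$ and the left-invariant Lorentzian metric $dx_1^2+dx_2^2-(dx_3+\tfrac12(x_2dx_1-x_1dx_2))^2$; $e_1,e_2,e_3$ is the left-invariant orthonormal frame equal to $\partial_1,\partial_2,\partial_3$ at the origin. A *maximal surface* on an open set $\Omega\subset\mathbb C$ is a smooth conformal spacelike immersion $\Omega\to\mathrm{Nil}_1^3$ with mean curvature $0$. A *maximal surface with singularities* is a smooth map, conformal (the induced, possibly degenerate, metric is a multiple of $|dz|^2$) and harmonic; its singular points are those where the induced metric is not Riemannian. Smooth functions $\psi_1,\psi_2$ are *generating spinors* of $f$ if $f^{-1}f_z=\varphi_1e_1+\varphi_2e_2+\varphi_3e_3$ with $$\varphi_1=\overline{\psi_2}^{\,2}-\psi_1^2,\qquad \varphi_2=i(\overline{\psi_2}^{\,2}+\psi_1^2),\qquad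 \varphi_3=2i\psi_1\overline{\psi_2}.$$ Put $h=2(|\psi_1|^2+|\psi_2|^2)$, $e^{w/2}=-\tfrac h4$ (so $\tfrac14w_z=\tfrac{h_z}{2h}$) and $B=\tfrac12\bigl(\psi_1(\overline{\psi_2})_z-\overline{\psi_2}(\psi_1)_z\bigr)$. A map $f^*$ is *dual* to $f$ if locally $(f^*)^{-1}f^*_z$ is given by the same formulas with the dual spinors $\psi_1^*=\tfrac{4s}{h}\psi_2$, $\psi_2^*=\tfrac{4\bar s}{h}\psi_1$, where $s^2=-B$ pointwise (the choice of $s$ does not matter). Let $D\subset\mathbb C$ be a connected non-empty open set (for instance simply connected), $f$ a maximal surface on $D$ with generating spinors $\psi_1,\psi_2$ and $B\not\equiv0$. Let $F=F(z,\lambda)$, $z\in D$, $\lambda\in\mathbb S^1$, be an extended frame of $f$: a smooth $\mathrm{SU}_2$-valued map with $F^{-1}dF=U^\lambda dz+V^\lambda d\bar z$, $$U^\lambda=\begin{pmatrix}\frac14w_z&-\lambda^{-1}e^{w/2}\\ \lambda^{-1}Be^{-w/2}&-\frac14w_z\end{pmatrix},\quad V^\lambda=\begin{pmatrix}-\frac14w_{\bar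 z}&-\lambda\overline Be^{-w/2}\\ \lambda e^{w/2}&\frac14w_{\bar z}\end{pmatrix},\quad F(\cdot,1)=\frac{1}{\sqrt{|\psi_1|^2+|\psi_2|^2}}\begin{pmatrix}\psi_1&\psi_2\\-\overline{\psi_2}&\overline{\psi_1}\end{pmatrix}.$$ Let $E_1=\frac12\begin{pmatrix}0&-i\\-i&0\end{pmatrix}$, $E_2=\frac12\begin{pmatrix}0&1\\-1&0\end{pmatrix}$, $E_3=\frac12\begin{pmatrix}i&0\\0&-i\end{pmatrix}$ be the basis of $\mathfrak{su}_2$, $\Xi_{\mathrm{nil}}(x_1E_1+x_2E_2+x_3E_3)=(x_1,x_2,x_3)$, $\sigma_3=\mathrm{diag}(1,-1)$, and define $$N_m=\tfrac i2\mathrm{Ad}(F)\sigma_3,\qquad m_\pm=\pm i\lambda(\partial_\lambda F)F^{-1}-N_m,\qquad f^\lambda_\pm=\Xi_{\mathrm{nil}}\bigl(m_\pm^{\mathrm o}\pm\tfrac i2\lambda(\partial_\lambda m_\pm)^{\mathrm d}\bigr),$$ where $\mathrm o$ and $\mathrm d$ denote off-diagonal and diagonal parts and $\lambda\partial_\lambda=-i\,\partial_t$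 for $\lambda=e^{it}$. For $\lambda\in\mathbb S^1$ let $D_\lambda\subset D$ be the set of points at which $|F_{11}(\lambda)|\ne|F_{12}(\lambda)|$. *Claim.* The zeros of $B$ are isolated, and the following holds. 1. For every $\lambda\in\mathbb S^1$, the matrices to which $\Xi_{\mathrm{nil}}$ is applied lie in $\mathfrak{su}_2$, and $f^\lambda_-$ and $f^\lambda_+$ are maximal surfaces with singularities on $D$. The non-singular points of $f^\lambda_-$ are those of $D_\lambda$, the non-singular points of $f^\lambda_+$ are those of $D_\lambda$ with $B\neq0$, and on these sets $f^\lambda_-$ and $f^\lambda_+$ are maximal surfaces. 2. For every $\lambda$, $N_m$ is the normal Gauss map of $f_\pm^\lambda$: there is a smooth $n=n_1e_1+n_2e_2+n_3e_3$ on $D_\lambda$ which is a left-translated unit normal of $f_-^\lambda$ on $D_\lambda$ and of $f^\lambda_+$ on $D_\lambda\cap\{B\ne0\}$, such that $N_m$ takes values in the unit sphere of $\mathfrak{su}_2$ (with $E_1,E_2,E_3$ as orthonormal basis) and the stereographic projection $\frac{x_1+ix_2}{1-x_3}$ of $N_m=\sum x_kE_k$ equals the stereographic projection $g=\frac{-i(n_1+in_2)}{1+n_3}$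 of $n$, in $\mathbb C\cup\{\infty\}$. 3. For every $\lambda$, $f_-^\lambda$ and $f_+^\lambda$ are dual to each other: $f^\lambda_+$ is dual to $f^\lambda_-$ on $D$, and $f^\lambda_-$ is dual to $f^\lambda_+$ on $\{B\ne0\}$. 4. $D_1=D$; $f_-^\lambda|_{\lambda=1}$ is $f$ up to a left translation, and $f_+^\lambda|_{\lambda=1}$ is dual to $f$. 5. For every $\lambda$, $\Xi_{\mathrm{nil}}\bigl((-m_+)^{\mathrm o}-\tfrac i2\lambda(\partial_\lambda(-m_+))^{\mathrm d}\bigr)$ is the image of $f_+^\lambda$ under the rigid motion $(x_1,x_2,x_3)\mapsto(-x_1,-x_2,x_3)$. -/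

import Mathlib

open scoped ContDiff Topology ComplexConjugate

noncomputable section

namespace NilSurface

/-! ### The Lorentzian Heisenberg group -/

/-- The underlying space of the Heisenberg group, with coordinates `(x₁, x₂, x₃) = (p 0, p 1, p 2)`.
The same type is used for its Lie algebra, with coordinates with respect to the left-invariant
frame `e₁ = ∂₁ - (x₂/2)∂₃`, `e₂ = ∂₂ + (x₁/2)∂₃`, `e₃ = ∂₃`. -/
abbrev Nil := Fin 3 → ℝ

/-- The group multiplication of the Heisenberg group. -/
def nilMul (p q : Nil) : Nil :=
  ![p 0 + q 0, p 1 + q 1, p 2 + q 2 + (p 0 * q 1 - q 0 * p 1) / 2]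

/-- The left-invariant Maurer-Cartan form of the Heisenberg group: left translation to the
identity of the tangent vector `v` at the point `p`. -/
def leftTranslate (p v : Nil) : Nil :=
  ![v 0, v 1, v 2 + (p 1 * v 0 - p 0 * v 1) / 2]

theorem nilMul_neg_self (p : Nil) : nilMul (-p) p = 0 := by
  ext k
  fin_cases k <;> simp [nilMul]

/-- `leftTranslate p` is the differential at `p` of the left translation by `p⁻¹ = -p`. -/
theorem hasDerivAt_nilMul_neg (p v : Nil) :
    HasDerivAt (fun t : ℝ => nilMul (-p) (p + t • v)) (leftTranslate p v) 0 := by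
  rw [hasDerivAt_pi]
  intro k
  have key : ∀ (c d : ℝ) (g : ℝ → ℝ), (∀ t, g t = c + t * d) → HasDerivAt g d 0 := by
    intro c d g hg
    have h1 : g = fun t => c + t * d := funext hg
    rw [h1]
    simpa using ((hasDerivAt_id (0 : ℝ)).mul_const d).const_add c
  fin_cases k
  · exact key 0 _ _ fun t => by simp [nilMul, leftTranslate]
  · exact key 0 _ _ fun t => by simp [nilMul, leftTranslate]
  · exact key 0 _ _ fun t => by simp [nilMul, leftTranslate]; ring

/-- The Lorentzian inner product on the Lie algebra for which `e₁, e₂, e₃` is orthonormal and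
`e₃` is timelike.  Left translated, it is the metric
`dx₁² + dx₂² - (dx₃ + (x₂ dx₁ - x₁ dx₂)/2)²`. -/
def lip (X Y : Nil) : ℝ := X 0 * Y 0 + X 1 * Y 1 - X 2 * Y 2

/-- The Lie bracket of the Heisenberg algebra: `[e₁, e₂] = e₃`, `e₃` central. -/
def bracket (X Y : Nil) : Nil := ![0, 0, X 0 * Y 1 - X 1 * Y 0]

/-- The basis vectors `e₁, e₂, e₃`. -/
def e (k : Fin 3) : Nil := Pi.single k 1

/-- The Levi-Civita connection of the left-invariant metric on left-invariant vector fields,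
given by the Koszul formula
`2⟨∇_X Y, Z⟩ = ⟨[X, Y], Z⟩ - ⟨[Y, Z], X⟩ + ⟨[Z, X], Y⟩`. -/
def conn (X Y : Nil) : Nil := fun k =>
  lip (e k) (e k) / 2 *
    (lip (bracket X Y) (e k) - lip (bracket Y (e k)) X + lip (bracket (e k) X) Y)

/-! ### Surfaces, parametrized by (subsets of) the complex plane -/

/-- The Maurer-Cartan form `f⁻¹ df` of a map `f`, evaluated at the point `z` on the real tangent
vector `v` of the parameter plane. -/
def mc (f : ℂ → Nil) (z v : ℂ) : Nil := leftTranslate (f z) (fderiv ℝ f z v)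

/-- The induced metric (first fundamental form) of `f`. -/
def firstForm (f : ℂ → Nil) (z v w : ℂ) : ℝ := lip (mc f z v) (mc f z w)

/-- The Levi-Civita covariant derivative, in the direction `v`, of a vector field along `f`,
both the field and its derivative being left translated to the identity. -/
def covDeriv (f Y : ℂ → Nil) (z v : ℂ) : Nil := fderiv ℝ Y z v + conn (mc f z v) (Y z)

/-- `n` is the left translation of a (timelike) unit normal vector of `f` at `z`. -/
def IsUnitNormal (f : ℂ → Nil) (z : ℂ) (n : Nil) : Prop :=
  lip n n = -1 ∧ ∀ v : ℂ, lip (mc f z v) n = 0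

/-- The second fundamental form with respect to the timelike unit normal `n`: the normal part of
the covariant derivative of `df(w)` in the direction `v` is `secondForm f z n v w • n`. -/
def secondForm (f : ℂ → Nil) (z : ℂ) (n : Nil) (v w : ℂ) : ℝ :=
  -lip (covDeriv f (fun ζ => mc f ζ w) z v) n

/-- The mean curvature of `f` at `z` with respect to the unit normal `n`: half the trace of the
second fundamental form with respect to the first. -/
def meanCurvature (f : ℂ → Nil) (z : ℂ) (n : Nil) : ℝ :=
  (firstForm f z Complex.I Complex.I * secondForm f z n 1 1
      - 2 * firstForm f z 1 Complex.I * secondForm f z n 1 Complex.I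
      + firstForm f z 1 1 * secondForm f z n Complex.I Complex.I) /
    (2 * (firstForm f z 1 1 * firstForm f z Complex.I Complex.I - firstForm f z 1 Complex.I ^ 2))

/-- The induced metric is Riemannian at `z` (in particular, `f` is an immersion at `z`). -/
def IsSpacelikeAt (f : ℂ → Nil) (z : ℂ) : Prop := ∀ v : ℂ, v ≠ 0 → 0 < firstForm f z v v

/-- The induced (possibly degenerate) metric at `z` is a multiple of `|dz|²`. -/
def IsConformalAt (f : ℂ → Nil) (z : ℂ) : Prop :=
  firstForm f z 1 1 = firstForm f z Complex.I Complex.I ∧ firstForm f z 1 Complex.I = 0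

/-- A maximal surface on the open set `Ω`: a smooth conformal spacelike immersion whose mean
curvature vanishes. -/
structure IsMaximalSurface (Ω : Set ℂ) (f : ℂ → Nil) : Prop where
  smooth : ContDiffOn ℝ ∞ f Ω
  spacelike : ∀ z ∈ Ω, IsSpacelikeAt f z
  conformal : ∀ z ∈ Ω, IsConformalAt f z
  mean_zero : ∀ z ∈ Ω, ∀ n : Nil, IsUnitNormal f z n → meanCurvature f z n = 0

/-- The tension field `∇_x f_x + ∇_y f_y`, left translated to the identity.  At the points where a
conformal map is a spacelike immersion, it vanishes exactly when the mean curvature does; unlike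
the mean curvature it makes sense at singular points. -/
def tension (f : ℂ → Nil) (z : ℂ) : Nil :=
  covDeriv f (fun ζ => mc f ζ 1) z 1 + covDeriv f (fun ζ => mc f ζ Complex.I) z Complex.I

/-- A maximal surface on `Ω`, singular points (points at which the induced metric degenerates)
being allowed: a smooth, conformal map that is harmonic into the Lorentzian Heisenberg group. -/
structure IsSingularMaximalSurface (Ω : Set ℂ) (f : ℂ → Nil) : Prop where
  smooth : ContDiffOn ℝ ∞ f Ω
  conformal : ∀ z ∈ Ω, IsConformalAt f z
  harmonic : ∀ z ∈ Ω, tension f z = 0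

/-! ### Generating spinors and the dual surface -/

/-- The Wirtinger derivative `∂/∂z`. -/
def dz (g : ℂ → ℂ) (z : ℂ) : ℂ := (fderiv ℝ g z 1 - Complex.I * fderiv ℝ g z Complex.I) / 2

/-- The Wirtinger derivative `∂/∂z̄`. -/
def dzbar (g : ℂ → ℂ) (z : ℂ) : ℂ := (fderiv ℝ g z 1 + Complex.I * fderiv ℝ g z Complex.I) / 2

/-- The components `φ₁, φ₂, φ₃` of `f⁻¹ f_z = φ₁ e₁ + φ₂ e₂ + φ₃ e₃`. -/
def mcz (f : ℂ → Nil) (z : ℂ) : Fin 3 → ℂ := fun k =>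
  ((mc f z 1 k : ℂ) - Complex.I * (mc f z Complex.I k : ℂ)) / 2

/-- The vector `(φ₁, φ₂, φ₃)` determined by the values `a, b` of the spinors `ψ₁, ψ₂`. -/
def spinorVec (a b : ℂ) : Fin 3 → ℂ :=
  ![conj b ^ 2 - a ^ 2, Complex.I * (conj b ^ 2 + a ^ 2), 2 * Complex.I * a * conj b]

/-- `(ψ₁, ψ₂)` is a pair of generating spinors of `f` on the open set `Ω`. -/
structure IsGeneratingSpinors (Ω : Set ℂ) (f : ℂ → Nil) (ψ₁ ψ₂ : ℂ → ℂ) : Prop where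
  smooth₁ : ContDiffOn ℝ ∞ ψ₁ Ω
  smooth₂ : ContDiffOn ℝ ∞ ψ₂ Ω
  mcz_eq : ∀ z ∈ Ω, mcz f z = spinorVec (ψ₁ z) (ψ₂ z)

/-- The support function `h = ⟨f⁻¹L, e₃⟩` in terms of the spinors, where
`L = e^{u/2} N` with `e^{u/2} = 2(|ψ₁|² - |ψ₂|²)`. -/
def supportFn (ψ₁ ψ₂ : ℂ → ℂ) (z : ℂ) : ℝ := 2 * (‖ψ₁ z‖ ^ 2 + ‖ψ₂ z‖ ^ 2)

/-- The Dirac potential `e^{w/2} = -h/4` of a maximal surface (mean curvature zero). -/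
def diracPotential (ψ₁ ψ₂ : ℂ → ℂ) (z : ℂ) : ℂ := -(supportFn ψ₁ ψ₂ z : ℂ) / 4

/-- The coefficient `B` of the Abresch-Rosenberg differential `4B dz²` of a maximal surface
(mean curvature zero). -/
def abreschRosenberg (ψ₁ ψ₂ : ℂ → ℂ) (z : ℂ) : ℂ :=
  (ψ₁ z * dz (fun ζ => conj (ψ₂ ζ)) z - conj (ψ₂ z) * dz ψ₁ z) / 2

/-- `fs` is a dual surface of `f` on the open set `Ω`: near every point of `Ω` there are generating
spinors `(ψ₁, ψ₂)` of `f`, without common zeros, such that `fs` is given by the dual spinors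
`ψ₁* = (4 √(-B) / h) ψ₂`, `ψ₂* = (4 conj √(-B) / h) ψ₁`.

Generating spinors are determined by `f` up to a common sign on small connected sets, and
`spinorVec (ψ₁*) (ψ₂*)` depends neither on this sign nor on the choice, at each point, of the
square root `s` of `-B`.  Thus `fs` is determined up to left translations on connected sets.  The
definition is local because the spinors of a surface with branch points may have no global smooth
choice off the branch points. -/
def IsDualSurface (Ω : Set ℂ) (f fs : ℂ → Nil) : Prop :=
  ∀ z₀ ∈ Ω, ∃ W : Set ℂ, IsOpen W ∧ z₀ ∈ W ∧ W ⊆ Ω ∧ ∃ ψ₁ ψ₂ s : ℂ → ℂ,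
    IsGeneratingSpinors W f ψ₁ ψ₂ ∧
    (∀ z ∈ W, supportFn ψ₁ ψ₂ z ≠ 0) ∧
    (∀ z ∈ W, s z ^ 2 = -abreschRosenberg ψ₁ ψ₂ z) ∧
    ∀ z ∈ W, mcz fs z =
      spinorVec (4 * s z / supportFn ψ₁ ψ₂ z * ψ₂ z) (4 * conj (s z) / supportFn ψ₁ ψ₂ z * ψ₁ z)

/-! ### Extended frames -/

/-- The `dz`-part of the family of Maurer-Cartan forms `α^λ`.  Here `w_z / 4` is written as
`P_z / (2P)` with `P = e^{w/2}` the Dirac potential. -/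
def frameU (ψ₁ ψ₂ : ℂ → ℂ) (l : Circle) (z : ℂ) : Matrix (Fin 2) (Fin 2) ℂ :=
  let P := diracPotential ψ₁ ψ₂
  let B := abreschRosenberg ψ₁ ψ₂
  !![dz P z / (2 * P z), -((l : ℂ)⁻¹ * P z);
     (l : ℂ)⁻¹ * (B z / P z), -(dz P z / (2 * P z))]

/-- The `dz̄`-part of the family of Maurer-Cartan forms `α^λ`. -/
def frameV (ψ₁ ψ₂ : ℂ → ℂ) (l : Circle) (z : ℂ) : Matrix (Fin 2) (Fin 2) ℂ :=
  let P := diracPotential ψ₁ ψ₂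
  let B := abreschRosenberg ψ₁ ψ₂
  !![-(dzbar P z / (2 * P z)), -((l : ℂ) * (conj (B z) / P z));
     (l : ℂ) * P z, dzbar P z / (2 * P z)]

/-- `F` is an extended frame of the maximal surface with generating spinors `(ψ₁, ψ₂)`: an
`SU₂`-valued solution of `F⁻¹dF = α^λ`, smooth in `(z, λ)`, whose value at `λ = 1` is the
normalized matrix of the spinors. -/
structure IsExtendedFrame (D : Set ℂ) (ψ₁ ψ₂ : ℂ → ℂ)
    (F : ℂ → Circle → Matrix (Fin 2) (Fin 2) ℂ) : Prop where
  smooth : ∀ i j, ContDiffOn ℝ ∞ (fun p : ℂ × ℝ => F p.1 (Circle.exp p.2) i j) (D ×ˢ Set.univ)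
  mem_SU : ∀ z ∈ D, ∀ l, F z l ∈ Matrix.specialUnitaryGroup (Fin 2) ℂ
  dz_eq : ∀ z ∈ D, ∀ l, (F z l)⁻¹ * Matrix.of (fun i j => dz (fun ζ => F ζ l i j) z) =
    frameU ψ₁ ψ₂ l z
  dzbar_eq : ∀ z ∈ D, ∀ l, (F z l)⁻¹ * Matrix.of (fun i j => dzbar (fun ζ => F ζ l i j) z) =
    frameV ψ₁ ψ₂ l z
  at_one : ∀ z ∈ D, F z 1 = ((Real.sqrt (‖ψ₁ z‖ ^ 2 + ‖ψ₂ z‖ ^ 2) : ℝ) : ℂ)⁻¹ •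
    !![ψ₁ z, ψ₂ z; -conj (ψ₂ z), conj (ψ₁ z)]

/-! ### The Sym formula -/

/-- The derivative `λ ∂_λ G = -i d/dt G(λ e^{it})|_{t=0}` along the unit circle. -/
def lambdaDeriv (G : Circle → Matrix (Fin 2) (Fin 2) ℂ) (l : Circle) :
    Matrix (Fin 2) (Fin 2) ℂ :=
  Matrix.of fun i j => -Complex.I * deriv (fun t : ℝ => G (l * Circle.exp t) i j) 0

/-- The Pauli matrix `σ₃`. -/
def sigma3 : Matrix (Fin 2) (Fin 2) ℂ := !![1, 0; 0, -1]

/-- `N_m = (i/2) Ad(F) σ₃`. -/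
def symN (F : ℂ → Circle → Matrix (Fin 2) (Fin 2) ℂ) (z : ℂ) (l : Circle) :
    Matrix (Fin 2) (Fin 2) ℂ :=
  (Complex.I / 2) • (F z l * sigma3 * (F z l)⁻¹)

/-- `m_± = ± i λ (∂_λ F) F⁻¹ - N_m`, where the sign is `ε = ±1`. -/
def symM (ε : ℂ) (F : ℂ → Circle → Matrix (Fin 2) (Fin 2) ℂ) (z : ℂ) (l : Circle) :
    Matrix (Fin 2) (Fin 2) ℂ :=
  (ε * Complex.I) • (lambdaDeriv (F z) l * (F z l)⁻¹) - symN F z l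

/-- The diagonal part of a matrix. -/
def diagPart (M : Matrix (Fin 2) (Fin 2) ℂ) : Matrix (Fin 2) (Fin 2) ℂ := !![M 0 0, 0; 0, M 1 1]

/-- The off-diagonal part of a matrix. -/
def offPart (M : Matrix (Fin 2) (Fin 2) ℂ) : Matrix (Fin 2) (Fin 2) ℂ := !![0, M 0 1; M 1 0, 0]

/-- For a loop of matrices `m` and a sign `ε = ±1`, the expression
`m^o + ε (i/2) λ (∂_λ m)^d`. -/
def symExpr (ε : ℂ) (m : Circle → Matrix (Fin 2) (Fin 2) ℂ) (l : Circle) :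
    Matrix (Fin 2) (Fin 2) ℂ :=
  offPart (m l) + (ε * (Complex.I / 2)) • diagPart (lambdaDeriv m l)

/-- The basis `E₁, E₂, E₃` of `su₂`. -/
def suBasis : Fin 3 → Matrix (Fin 2) (Fin 2) ℂ :=
  ![(1 / 2 : ℂ) • !![0, -Complex.I; -Complex.I, 0],
    (1 / 2 : ℂ) • !![0, 1; -1, 0],
    (1 / 2 : ℂ) • !![Complex.I, 0; 0, -Complex.I]]

/-- The element `x₁ E₁ + x₂ E₂ + x₃ E₃` of `su₂`. -/
def suOfCoords (x : Nil) : Matrix (Fin 2) (Fin 2) ℂ := ∑ k, (x k : ℂ) • suBasis k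

/-- The identification `Ξ_nil : x₁ E₁ + x₂ E₂ + x₃ E₃ ↦ (x₁, x₂, x₃)` of `su₂` with the Heisenberg
group (meaningful for matrices in `su₂`). -/
def xiNil (M : Matrix (Fin 2) (Fin 2) ℂ) : Nil :=
  ![(Complex.I * (M 0 1 + M 1 0)).re, (M 0 1 - M 1 0).re, (-2 * Complex.I * M 0 0).re]

theorem xiNil_suOfCoords (x : Nil) : xiNil (suOfCoords x) = x := by
  ext k
  fin_cases k <;> simp [xiNil, suOfCoords, suBasis, Fin.sum_univ_three] <;> ring

/-- The matrix `m_±^o ± (i/2) λ (∂_λ m_±)^d` whose image under `Ξ_nil` is the surface `f_±^λ`,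
where the sign is `ε = ±1`. -/
def symHat (ε : ℂ) (F : ℂ → Circle → Matrix (Fin 2) (Fin 2) ℂ) (l : Circle) (z : ℂ) :
    Matrix (Fin 2) (Fin 2) ℂ :=
  symExpr ε (symM ε F z) l

/-- The surfaces `f_+^λ` (`ε = 1`) and `f_-^λ` (`ε = -1`). -/
def symSurface (ε : ℂ) (F : ℂ → Circle → Matrix (Fin 2) (Fin 2) ℂ) (l : Circle) (z : ℂ) : Nil :=
  xiNil (symHat ε F l z)

/-! ### The normal Gauss map -/

/-- The stereographic projection `π` from the south pole `-e₃` of the hyperbolic planes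
`⟨n, n⟩ = -1` to the extended plane, normalized (by the factor `-i`) such that the normal
`(2 Im g e₁ - 2 Re g e₂ - (|g|² + 1) e₃) / (|g|² - 1)` is projected to `g`. -/
def hypProj (n : Nil) : OnePoint ℂ :=
  if n 2 = -1 then OnePoint.infty
  else ((-Complex.I * ((n 0 : ℂ) + Complex.I * (n 1 : ℂ)) / (1 + (n 2 : ℂ)) : ℂ) : OnePoint ℂ)

/-- The stereographic projection from the north pole of the unit sphere `x₁² + x₂² + x₃² = 1` in
`su₂`, in the coordinates of the basis `E₁, E₂, E₃`. -/
def sphereProj (x : Nil) : OnePoint ℂ :=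
  if x 2 = 1 then OnePoint.infty
  else ((((x 0 : ℂ) + Complex.I * (x 1 : ℂ)) / (1 - (x 2 : ℂ)) : ℂ) : OnePoint ℂ)

/-- `Nm`, a map to `su₂`, is the normal Gauss map on `Ω` of `f` with respect to the smooth unit
normal `n` (left translated to the identity): it takes values in the unit sphere of `su₂`, and it
is the map `π ∘ n` once the sphere is identified with the extended plane. -/
structure IsNormalGaussMap (Ω : Set ℂ) (f n : ℂ → Nil)
    (Nm : ℂ → Matrix (Fin 2) (Fin 2) ℂ) : Prop where
  smooth : ContDiffOn ℝ ∞ n Ω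
  normal : ∀ z ∈ Ω, IsUnitNormal f z (n z)
  sphere : ∀ z ∈ Ω, ∃ x : Nil, Nm z = suOfCoords x ∧ x 0 ^ 2 + x 1 ^ 2 + x 2 ^ 2 = 1 ∧
    sphereProj x = hypProj (n z)

/-- The rotation by the angle `π` about the `x₃`-axis, an isometric automorphism of the
Lorentzian Heisenberg group. -/
def halfTurn (p : Nil) : Nil := ![-p 0, -p 1, p 2]

/-- The points of `D` at which the two entries in the first row of the frame `F(λ)` have different
absolute values (for `λ = 1`: `|ψ₁| ≠ |ψ₂|`). -/
def regularSet (D : Set ℂ) (F : ℂ → Circle → Matrix (Fin 2) (Fin 2) ℂ) (l : Circle) : Set ℂ :=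
  {z | z ∈ D ∧ ‖F z l 0 0‖ ≠ ‖F z l 0 1‖}

end NilSurface

end

open NilSurface

/-! Everything is read off from the first row `(a, b)` of the frame, since membership in SU₂
determines the second row and the first row of `F * U` and `F * V` involves only the first row of
`F`. Write `P = e^{w/2}`, `p = P_z / (2P)`, `Q = B / P`. In the `z`-derivative of the off-diagonal
entry of `m_ε` all terms with `p` or `∂_t a`, `∂_t b` cancel; a term in `P` with factor `ε - 1` and
a term in `Q` with factor `ε + 1` remain. In the third coordinate the surviving `t`-derivatives are
absorbed by the Heisenberg correction `(x₂ dx₁ - x₁ dx₂)/2`, by means of `|a|² + |b|² = 1` and its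
`t`-derivative. Hence (`mc_rowSurface`) the left-translated `z`-derivative is `-2Pλ⁻¹ • spinorVec a
b` for `f_-` and `2Qλ⁻¹ • spinorVec b a` for `f_+`.

The claims follow from these two formulas. Any multiple `c • spinorVec x y` gives the conformal
metric `4|c|²(|x|² - |y|²)²|dz|²`, which locates the singular points. Harmonicity is a computation
of `z̄`-derivatives in which `p` cancels; for `f_+` it needs `Q_z̄ = -2Q p̄`, that is, holomorphy of
`B`, which comes from the Dirac equation contained in the frame at `λ = 1`. Exchanging `x` and `y`
does not change the normal line, so both surfaces have the same Gauss map.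

For duality, absorb a square root `ρ` of `c` into the spinors `ρx`, `ρ̄y`. The dual then has the
form `-2w • spinorVec y x` with the Wronskian `w = x ȳ_z - ȳ x_z`, whatever `c` is. For `(a, b)` the
Wronskian is `-λ⁻¹Q` and for `(b, a)` it is `λ⁻¹P`: exactly the coefficients of the other surface.
At `λ = 1` the factor `-2P = |ψ₁|² + |ψ₂|²` undoes the normalization of the frame, so `f_-` and `f`
have the same Maurer-Cartan form and differ by a left translation. -/

open NilSurface

noncomputable section

namespace NilSurface

/-! ### Wirtinger calculus -/

/-- `g` is real differentiable at `z`, with Wirtinger derivatives `α = ∂g/∂z`, `β = ∂g/∂z̄`. -/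
def HasW (g : ℂ → ℂ) (z α β : ℂ) : Prop :=
  HasFDerivAt g (α • (ContinuousLinearMap.id ℝ ℂ) + β • (Complex.conjCLE : ℂ →L[ℝ] ℂ)) z

namespace HasW

variable {g k : ℂ → ℂ} {z α β α' β' : ℂ}

theorem differentiableAt (h : HasW g z α β) : DifferentiableAt ℝ g z :=
  HasFDerivAt.differentiableAt h

theorem fderiv_apply (h : HasW g z α β) (v : ℂ) : fderiv ℝ g z v = α * v + β * conj v := by
  rw [HasFDerivAt.fderiv h]
  simp

theorem congr (h : HasW g z α β) (hα : α = α') (hβ : β = β') : HasW g z α' β' := by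
  rwa [← hα, ← hβ]

theorem congr_fun (h : HasW g z α β) (hk : k =ᶠ[𝓝 z] g) : HasW k z α β :=
  HasFDerivAt.congr_of_eventuallyEq h hk

theorem of_fderiv (hg : DifferentiableAt ℝ g z)
    (h : ∀ v : ℂ, fderiv ℝ g z v = α * v + β * conj v) : HasW g z α β := by
  refine hg.hasFDerivAt.congr_fderiv ?_
  ext v
  all_goals simp [h]

theorem dz_eq (h : HasW g z α β) : dz g z = α := by
  unfold dz
  rw [h.fderiv_apply, h.fderiv_apply, Complex.conj_I, map_one]
  linear_combination (-α + β) / 2 * Complex.I_sq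

theorem dzbar_eq (h : HasW g z α β) : dzbar g z = β := by
  unfold dzbar
  rw [h.fderiv_apply, h.fderiv_apply, Complex.conj_I, map_one]
  linear_combination (α - β) / 2 * Complex.I_sq

theorem of_differentiableAt (hg : DifferentiableAt ℝ g z) :
    HasW g z (dz g z) (dzbar g z) := by
  refine of_fderiv hg fun v => ?_
  have hv : v = v.re • (1 : ℂ) + v.im • Complex.I := by
    simp [Complex.re_add_im]
  have hc : conj v = v.re - v.im * Complex.I := by
    apply Complex.ext <;> simp
  have hv' : v = v.re + v.im * Complex.I := (Complex.re_add_im v).symm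
  rw [hc]
  conv_lhs => rw [hv, map_add, map_smul, map_smul]
  conv_rhs => enter [1, 2]; rw [hv']
  unfold dz dzbar
  simp only [Complex.real_smul]
  linear_combination (v.im : ℂ) * fderiv ℝ g z Complex.I * Complex.I_sq

theorem const (c : ℂ) : HasW (fun _ => c) z 0 0 := by
  refine of_fderiv (differentiableAt_const c) fun v => ?_
  simp

theorem add (h : HasW g z α β) (h' : HasW k z α' β') :
    HasW (fun ζ => g ζ + k ζ) z (α + α') (β + β') := by
  refine of_fderiv (h.differentiableAt.add h'.differentiableAt) fun v => ?_
  rw [fderiv_fun_add h.differentiableAt h'.differentiableAt]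
  simp only [add_apply, h.fderiv_apply, h'.fderiv_apply]
  ring

theorem sub (h : HasW g z α β) (h' : HasW k z α' β') :
    HasW (fun ζ => g ζ - k ζ) z (α - α') (β - β') := by
  refine of_fderiv (h.differentiableAt.sub h'.differentiableAt) fun v => ?_
  rw [fderiv_fun_sub h.differentiableAt h'.differentiableAt]
  simp only [sub_apply, h.fderiv_apply, h'.fderiv_apply]
  ring

theorem mul (h : HasW g z α β) (h' : HasW k z α' β') :
    HasW (fun ζ => g ζ * k ζ) z (α * k z + g z * α') (β * k z + g z * β') := by
  refine of_fderiv (h.differentiableAt.mul h'.differentiableAt) fun v => ?_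
  rw [fderiv_fun_mul h.differentiableAt h'.differentiableAt]
  simp only [add_apply, smul_apply, smul_eq_mul,
    h.fderiv_apply, h'.fderiv_apply]
  ring

theorem const_mul (c : ℂ) (h : HasW g z α β) :
    HasW (fun ζ => c * g ζ) z (c * α) (c * β) :=
  ((const c).mul h).congr (by ring) (by ring)

theorem star (h : HasW g z α β) : HasW (fun ζ => conj (g ζ)) z (conj β) (conj α) := by
  have h1 : HasFDerivAt (fun ζ => conj (g ζ)) _ z :=
    ((Complex.conjCLE : ℂ →L[ℝ] ℂ).hasFDerivAt).comp z h
  refine of_fderiv h1.differentiableAt fun v => ?_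
  rw [h1.fderiv]
  simp
  ring

theorem inv (h : HasW g z α β) (hz : g z ≠ 0) :
    HasW (fun ζ => (g ζ)⁻¹) z (-α / g z ^ 2) (-β / g z ^ 2) := by
  have h1 := (hasDerivAt_inv hz).comp_hasFDerivAt_of_eq z h rfl
  refine of_fderiv h1.differentiableAt fun v => ?_
  erw [h1.fderiv]
  simp
  ring

end HasW

theorem HasW.unique {g : ℂ → ℂ} {z α β α' β' : ℂ} (h : HasW g z α β) (h' : HasW g z α' β') :
    α = α' ∧ β = β' :=
  ⟨h.dz_eq.symm.trans h'.dz_eq, h.dzbar_eq.symm.trans h'.dzbar_eq⟩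

theorem contDiffOn_fderiv_apply {E G : Type*} [NormedAddCommGroup E] [NormedSpace ℝ E]
    [NormedAddCommGroup G] [NormedSpace ℝ G] {S : Set E} (hS : IsOpen S) {g : E → G}
    (hg : ContDiffOn ℝ ∞ g S) (v : E) : ContDiffOn ℝ ∞ (fun p => fderiv ℝ g p v) S :=
  (hg.fderiv_of_isOpen hS (by simp)).clm_apply contDiffOn_const

theorem contDiffOn_dz {S : Set ℂ} (hS : IsOpen S) {g : ℂ → ℂ} (hg : ContDiffOn ℝ ∞ g S) :
    ContDiffOn ℝ ∞ (dz g) S :=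
  (((contDiffOn_fderiv_apply hS hg 1).sub
    (contDiffOn_const.mul (contDiffOn_fderiv_apply hS hg Complex.I))).div_const 2)

theorem contDiffOn_conj {E : Type*} [NormedAddCommGroup E] [NormedSpace ℝ E] {S : Set E}
    {g : E → ℂ} (hg : ContDiffOn ℝ ∞ g S) : ContDiffOn ℝ ∞ (fun ζ => conj (g ζ)) S :=
  (Complex.conjCLE : ℂ →L[ℝ] ℂ).contDiff.comp_contDiffOn hg

theorem differentiableAt_of_smooth {E G : Type*} [NormedAddCommGroup E] [NormedSpace ℝ E]
    [NormedAddCommGroup G] [NormedSpace ℝ G] {S : Set E} (hS : IsOpen S) {g : E → G}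
    (hg : ContDiffOn ℝ ∞ g S) {p : E} (hp : p ∈ S) : DifferentiableAt ℝ g p :=
  (hg.contDiffAt (hS.mem_nhds hp)).differentiableAt (by simp)

/-- Directional derivatives of smooth functions commute. -/
theorem fderiv_fderiv_comm {E G : Type*} [NormedAddCommGroup E] [NormedSpace ℝ E]
    [NormedAddCommGroup G] [NormedSpace ℝ G] {S : Set E} (hS : IsOpen S) {g : E → G}
    (hg : ContDiffOn ℝ ∞ g S) {p : E} (hp : p ∈ S) (v w : E) :
    fderiv ℝ (fun q => fderiv ℝ g q v) p w = fderiv ℝ (fun q => fderiv ℝ g q w) p v := by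
  have hd : DifferentiableAt ℝ (fderiv ℝ g) p :=
    differentiableAt_of_smooth hS (hg.fderiv_of_isOpen (m := ∞) hS (by simp)) hp
  have key : ∀ u : E, fderiv ℝ (fun q => fderiv ℝ g q u) p =
      (fderiv ℝ (fderiv ℝ g) p).flip u := by
    intro u
    rw [fderiv_clm_apply hd (differentiableAt_const u)]
    ext x
    simp
  rw [key, key]
  have hsymm : IsSymmSndFDerivAt ℝ g p :=
    (hg.contDiffAt (hS.mem_nhds hp)).isSymmSndFDerivAt
      (by simp only [minSmoothness_of_isRCLikeNormedField]; exact WithTop.coe_le_coe.2 le_top)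
  exact hsymm w v

/-- The Wirtinger derivatives of a smooth function commute. -/
theorem dzbar_dz_comm {S : Set ℂ} (hS : IsOpen S) {g : ℂ → ℂ} (hg : ContDiffOn ℝ ∞ g S)
    {z : ℂ} (hz : z ∈ S) : dzbar (dz g) z = dz (dzbar g) z := by
  have hd : ∀ v : ℂ, DifferentiableAt ℝ (fun q => fderiv ℝ g q v) z := fun v =>
    differentiableAt_of_smooth hS (contDiffOn_fderiv_apply hS hg v) hz
  have h1 := HasW.of_differentiableAt (hd 1)
  have h2 := HasW.of_differentiableAt (hd Complex.I)
  have ha : HasW (dz g) z _ _ :=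
    ((h1.sub (h2.const_mul Complex.I)).const_mul (1 / 2)).congr_fun
      (Filter.Eventually.of_forall fun ζ => by simp only [dz]; ring)
  have hb : HasW (dzbar g) z _ _ :=
    ((h1.add (h2.const_mul Complex.I)).const_mul (1 / 2)).congr_fun
      (Filter.Eventually.of_forall fun ζ => by simp only [dzbar]; ring)
  have hc := fderiv_fderiv_comm hS hg hz 1 Complex.I
  rw [ha.dzbar_eq, hb.dz_eq]
  unfold dz dzbar
  linear_combination Complex.I / 2 * hc

theorem contDiffOn_deriv_snd {S : Set ℂ} (hS : IsOpen S) {a : ℂ → ℝ → ℂ}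
    (ha : ContDiffOn ℝ ∞ (fun p : ℂ × ℝ => a p.1 p.2) (S ×ˢ Set.univ)) :
    ContDiffOn ℝ ∞ (fun p : ℂ × ℝ => deriv (a p.1) p.2) (S ×ˢ Set.univ) ∧
    ∀ z ∈ S, ∀ t, HasDerivAt (a z) (fderiv ℝ (fun p : ℂ × ℝ => a p.1 p.2) (z, t) (0, 1)) t := by
  have hO : IsOpen (S ×ˢ (Set.univ : Set ℝ)) := hS.prod isOpen_univ
  have key : ∀ z ∈ S, ∀ t,
      HasDerivAt (a z) (fderiv ℝ (fun p : ℂ × ℝ => a p.1 p.2) (z, t) (0, 1)) t := by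
    intro z hz t
    have h1 : HasFDerivAt (fun p : ℂ × ℝ => a p.1 p.2) _ (z, t) :=
      (differentiableAt_of_smooth hO ha ⟨hz, trivial⟩).hasFDerivAt
    have h2 : HasDerivAt (fun s : ℝ => ((z, s) : ℂ × ℝ)) (0, 1) t :=
      (hasDerivAt_const t z).prodMk (hasDerivAt_id t)
    exact h1.comp_hasDerivAt t h2
  refine ⟨?_, key⟩
  refine (contDiffOn_fderiv_apply hO ha (0, 1)).congr fun p hp => ?_
  exact (key p.1 hp.1 p.2).deriv

/-- The Wirtinger derivatives of a family of functions commute with the derivative with respect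
to the parameter. -/
theorem HasW.deriv_param {S : Set ℂ} (hS : IsOpen S) {a : ℂ → ℝ → ℂ} {α β : ℝ → ℂ}
    (ha : ContDiffOn ℝ ∞ (fun p : ℂ × ℝ => a p.1 p.2) (S ×ˢ Set.univ))
    {z : ℂ} (hz : z ∈ S) {t : ℝ}
    (hW : ∀ s, HasW (fun ζ => a ζ s) z (α s) (β s)) {α' β' : ℂ}
    (hα : HasDerivAt α α' t) (hβ : HasDerivAt β β' t) :
    HasW (fun ζ => deriv (a ζ) t) z α' β' := by
  have hO : IsOpen (S ×ˢ (Set.univ : Set ℝ)) := hS.prod isOpen_univ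
  obtain ⟨hsm, hder⟩ := contDiffOn_deriv_snd hS ha
  have slice : ∀ {g : ℂ × ℝ → ℂ} {s : ℝ}, DifferentiableAt ℝ g (z, s) →
      HasFDerivAt (fun ζ => g (ζ, s))
        ((fderiv ℝ g (z, s)).comp (ContinuousLinearMap.inl ℝ ℂ ℝ)) z := by
    intro g s hg
    have h2 : HasFDerivAt (fun ζ : ℂ => ((ζ, s) : ℂ × ℝ)) (ContinuousLinearMap.inl ℝ ℂ ℝ) z :=
      hasFDerivAt_prodMk_left z s
    exact hg.hasFDerivAt.comp z h2
  have h1 := slice (differentiableAt_of_smooth hO hsm (p := (z, t)) ⟨hz, trivial⟩)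
  refine HasW.of_fderiv h1.differentiableAt fun v => ?_
  rw [h1.fderiv]
  have hev : (fun p : ℂ × ℝ => deriv (a p.1) p.2) =ᶠ[𝓝 (z, t)]
      fun p => fderiv ℝ (fun p : ℂ × ℝ => a p.1 p.2) p (0, 1) := by
    filter_upwards [hO.mem_nhds (show (z, t) ∈ S ×ˢ Set.univ from ⟨hz, trivial⟩)] with p hp
    exact (hder p.1 hp.1 p.2).deriv
  rw [hev.fderiv_eq]
  simp only [ContinuousLinearMap.comp_apply, ContinuousLinearMap.inl_apply]
  -- By symmetry of the second derivative on `S × ℝ`, the `v`-derivative of the `t`-derivative is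
  -- the `t`-derivative of `α s * v + β s * conj v`.
  rw [fderiv_fderiv_comm hO ha ⟨hz, trivial⟩]
  have h3 : HasFDerivAt (fun p => fderiv ℝ (fun p : ℂ × ℝ => a p.1 p.2) p (v, 0)) _ (z, t) :=
    (differentiableAt_of_smooth hO (contDiffOn_fderiv_apply hO ha (v, 0))
      ⟨hz, trivial⟩).hasFDerivAt
  have h4 : HasDerivAt (fun s : ℝ => ((z, s) : ℂ × ℝ)) (0, 1) t :=
    (hasDerivAt_const t z).prodMk (hasDerivAt_id t)
  have h5 := h3.comp_hasDerivAt t h4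
  refine h5.unique ?_
  have h6 : ((fun p => fderiv ℝ (fun p : ℂ × ℝ => a p.1 p.2) p (v, 0)) ∘
      fun s : ℝ => ((z, s) : ℂ × ℝ)) = fun s => α s * v + β s * conj v := by
    funext s
    rw [← (hW s).fderiv_apply v]
    have := (slice (differentiableAt_of_smooth hO ha (p := (z, s)) ⟨hz, trivial⟩)).fderiv
    simp only at this
    rw [this]
    simp
  rw [h6]
  exact (hα.mul_const v).add (hβ.mul_const _)

/-! ### Surfaces given by spinors -/

theorem mc_eq_mcz (f : ℂ → Nil) (z v : ℂ) (k : Fin 3) : mc f z v k = 2 * (mcz f z k * v).re := by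
  have hv : v = v.re • (1 : ℂ) + v.im • Complex.I := by
    simp [Complex.re_add_im]
  have hlin : mc f z v = v.re • mc f z 1 + v.im • mc f z Complex.I := by
    unfold mc leftTranslate
    conv_lhs => rw [hv, map_add, map_smul, map_smul]
    ext k
    fin_cases k <;> simp
    ring
  rw [hlin]
  simp [mcz]
  ring

theorem mcz_eq_of_mc {f : ℂ → Nil} {z : ℂ} {φ : Fin 3 → ℂ}
    (h : ∀ v k, mc f z v k = 2 * (φ k * v).re) : mcz f z = φ := by
  funext k
  unfold mcz
  rw [h, h]
  apply Complex.ext <;> simp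

theorem mc_eq_of_mcz_eq {f g : ℂ → Nil} {z : ℂ} (h : mcz f z = mcz g z) (v : ℂ) :
    mc f z v = mc g z v := by
  funext k
  rw [mc_eq_mcz, mc_eq_mcz, h]

section Conformal

variable {f : ℂ → Nil} {z c x y : ℂ}

/-- The spinor vector is isotropic, `φ₁² + φ₂² - φ₃² = 0`, and `|φ₁|² + |φ₂|² - |φ₃|² = 2(|x|² -
|y|²)²`. The first identity kills the `v * w` part of the metric, the second gives the conformal
factor. -/
theorem firstForm_of_spinors (h : mcz f z = c • spinorVec x y) (v w : ℂ) :
    firstForm f z v w =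
      4 * ‖c‖ ^ 2 * (‖x‖ ^ 2 - ‖y‖ ^ 2) ^ 2 * (v * conj w).re := by
  unfold firstForm lip
  simp only [mc_eq_mcz, h, spinorVec]
  apply Complex.ofReal_injective
  push_cast
  simp only [Complex.re_eq_add_conj, ← Complex.mul_conj']
  have h2 : (starRingEnd ℂ) 2 = 2 := Complex.conj_ofNat 2
  simp [h2]
  ring_nf
  simp only [Complex.I_sq]
  ring

theorem isConformalAt_of_spinors (h : mcz f z = c • spinorVec x y) : IsConformalAt f z := by
  constructor <;> simp [firstForm_of_spinors h]

theorem isSpacelikeAt_iff_of_spinors (h : mcz f z = c • spinorVec x y) :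
    IsSpacelikeAt f z ↔ c ≠ 0 ∧ ‖x‖ ≠ ‖y‖ := by
  have key : ∀ v : ℂ, firstForm f z v v =
      4 * ‖c‖ ^ 2 * (‖x‖ ^ 2 - ‖y‖ ^ 2) ^ 2 * ‖v‖ ^ 2 := by
    intro v
    rw [firstForm_of_spinors h, Complex.mul_conj']
    norm_cast
  constructor
  · intro hs
    have h1 := hs 1 one_ne_zero
    rw [key] at h1
    constructor
    · rintro rfl
      simp at h1
    · intro he
      simp [he] at h1
  · rintro ⟨hc, hxy⟩ v hv
    rw [key]
    have : ‖x‖ ^ 2 - ‖y‖ ^ 2 ≠ 0 := by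
      rw [sub_ne_zero]
      intro he
      exact hxy ((sq_eq_sq₀ (norm_nonneg _) (norm_nonneg _)).1 he)
    have := norm_pos_iff.2 hc
    have := norm_pos_iff.2 hv
    positivity

end Conformal

/-- In the sum over the directions `1` and `I` the `z`-derivatives of the `φ_k` cancel, because `1²
+ I² = 0`; only the `z̄`-derivatives `β` matter. The right-hand sides are the quadratic terms of the
connection, where `∇_X X = (-X₁X₂, X₀X₂, 0)`. -/
theorem tension_eq_zero {f : ℂ → Nil} {z : ℂ} {β : Fin 3 → ℂ}
    (h : ∀ k, ∃ α, HasW (fun ζ => mcz f ζ k) z α (β k))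
    (h0 : (β 0).re = (mcz f z 1 * conj (mcz f z 2)).re)
    (h1 : (β 1).re = -(mcz f z 0 * conj (mcz f z 2)).re)
    (h2 : (β 2).re = 0) : tension f z = 0 := by
  choose α h using h
  have hD : ∀ u w : ℂ, ∀ k, fderiv ℝ (fun ζ => mc f ζ u) z w k =
      2 * ((α k * w + β k * conj w) * u).re := by
    intro u w k
    have hk : ∀ k, HasFDerivAt (fun ζ => mc f ζ u k)
        ((2 : ℝ) • (Complex.reCLM.comp (fderiv ℝ (fun ζ => mcz f ζ k * u) z))) z := by
      intro k
      have h3 := ((h k).mul (HasW.const u)).differentiableAt.hasFDerivAt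
      have h4 := ((Complex.reCLM.hasFDerivAt (x := mcz f z k * u)).comp z h3).const_smul (2 : ℝ)
      refine h4.congr_of_eventuallyEq (Filter.Eventually.of_forall fun ζ => ?_)
      simp [mc_eq_mcz]
    rw [(hasFDerivAt_pi.2 hk).fderiv]
    simp only [ContinuousLinearMap.coe_pi', smul_apply,
      ContinuousLinearMap.comp_apply, ((h k).mul (HasW.const u)).fderiv_apply]
    simp
    ring
  have hconn : ∀ X : Nil, conn X X = ![-(X 1 * X 2), X 0 * X 2, 0] := by
    intro X
    ext k
    fin_cases k <;> simp [conn, lip, bracket, e] <;> ring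
  ext k
  unfold tension covDeriv
  rw [hconn, hconn]
  simp only [Pi.add_apply, hD]
  simp only [mc_eq_mcz]
  fin_cases k
  · simp at h0 ⊢
    linear_combination 4 * h0
  · simp at h1 ⊢
    linear_combination 4 * h1
  · simp at h2 ⊢
    linear_combination 4 * h2

/-- For a conformal map the numerator of the mean curvature is the conformal factor times the trace
of the second form, and this trace is `-⟨tension, n⟩`. -/
theorem IsSingularMaximalSurface.isMaximalSurface {S Ω : Set ℂ} {f : ℂ → Nil}
    (hf : IsSingularMaximalSurface S f)
    (hΩS : Ω ⊆ S) (hs : ∀ z ∈ Ω, IsSpacelikeAt f z) : IsMaximalSurface Ω f where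
  smooth := hf.smooth.mono hΩS
  spacelike := hs
  conformal z hz := hf.conformal z (hΩS hz)
  mean_zero z hz n _ := by
    obtain ⟨h1, h2⟩ := hf.conformal z (hΩS hz)
    have h3 : lip (tension f z) n = 0 := by
      rw [hf.harmonic z (hΩS hz)]
      simp [lip]
    have h4 : secondForm f z n 1 1 + secondForm f z n Complex.I Complex.I = 0 := by
      unfold tension at h3
      unfold secondForm
      simp only [lip, Pi.add_apply] at h3 ⊢
      linear_combination -h3
    unfold meanCurvature
    rw [h2, ← h1]
    have : firstForm f z 1 1 * secondForm f z n 1 1 - 2 * 0 * secondForm f z n 1 Complex.I +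
        firstForm f z 1 1 * secondForm f z n Complex.I Complex.I = 0 := by
      linear_combination firstForm f z 1 1 * h4
    rw [this, zero_div]

theorem hasFDerivAt_coord {f : ℂ → Nil} {z : ℂ} (hf : DifferentiableAt ℝ f z) (k : Fin 3) :
    HasFDerivAt (fun ζ => f ζ k)
      ((ContinuousLinearMap.proj (R := ℝ) (φ := fun _ : Fin 3 => ℝ) k).comp (fderiv ℝ f z)) z :=
  hasFDerivAt_pi'.1 hf.hasFDerivAt k

/-- Maps with the same left-translated differential differ by a left translation. -/
theorem exists_nilMul_of_mcz_eq {D : Set ℂ} (hD : IsOpen D) (hDc : IsConnected D)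
    {f g : ℂ → Nil} (hf : ∀ z ∈ D, DifferentiableAt ℝ f z)
    (hg : ∀ z ∈ D, DifferentiableAt ℝ g z) (h : ∀ z ∈ D, mcz g z = mcz f z) :
    ∃ p : Nil, ∀ z ∈ D, g z = nilMul p (f z) := by
  -- The group inverse of `f z` is `-f z`, so this says that `g f⁻¹` is constant. Its third
  -- coordinate has zero derivative because the Maurer-Cartan forms of `f` and `g` agree in all
  -- three components.
  have hconst : ∀ k, ∃ c : ℝ, ∀ z ∈ D, nilMul (g z) (-f z) k = c := by
    intro k
    have hder : ∀ z ∈ D, HasFDerivAt (fun ζ => nilMul (g ζ) (-f ζ) k) (0 : ℂ →L[ℝ] ℝ) z := by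
      intro z hz
      have hF := fun k => hasFDerivAt_coord (hf z hz) k
      have hG := fun k => hasFDerivAt_coord (hg z hz) k
      have hmc := fun v => mc_eq_of_mcz_eq (h z hz) v
      have e0 : ∀ v, fderiv ℝ g z v 0 = fderiv ℝ f z v 0 := fun v => congrFun (hmc v) 0
      have e1 : ∀ v, fderiv ℝ g z v 1 = fderiv ℝ f z v 1 := fun v => congrFun (hmc v) 1
      have e2 : ∀ v, fderiv ℝ g z v 2 + (g z 1 * fderiv ℝ g z v 0 - g z 0 * fderiv ℝ g z v 1) / 2
          = fderiv ℝ f z v 2 + (f z 1 * fderiv ℝ f z v 0 - f z 0 * fderiv ℝ f z v 1) / 2 :=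
        fun v => congrFun (hmc v) 2
      fin_cases k
      · refine ((hG 0).sub (hF 0)).congr_fderiv ?_ |>.congr_of_eventuallyEq
          (Filter.Eventually.of_forall fun ζ => by simp [nilMul, sub_eq_add_neg])
        refine ContinuousLinearMap.ext fun v => ?_
        simp [e0]
      · refine ((hG 1).sub (hF 1)).congr_fderiv ?_ |>.congr_of_eventuallyEq
          (Filter.Eventually.of_forall fun ζ => by simp [nilMul, sub_eq_add_neg])
        refine ContinuousLinearMap.ext fun v => ?_
        simp [e1]
      · have h3 := ((hG 2).sub (hF 2)).add
          ((((hF 0).mul (hG 1)).sub ((hG 0).mul (hF 1))).const_mul (1 / 2 : ℝ))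
        refine h3.congr_fderiv ?_ |>.congr_of_eventuallyEq
          (Filter.Eventually.of_forall fun ζ => by
            simp [nilMul, sub_eq_add_neg]; ring)
        refine ContinuousLinearMap.ext fun v => ?_
        have := e2 v
        simp [e0, e1] at this ⊢
        linear_combination this
    obtain ⟨z₀, hz₀⟩ := hDc.nonempty
    refine ⟨_, fun z hz => hD.is_const_of_fderiv_eq_zero (𝕜 := ℝ) hDc.isPreconnected
      (fun w hw => (hder w hw).differentiableAt.differentiableWithinAt)
      (fun w hw => (hder w hw).fderiv) hz hz₀⟩
  choose p hp using hconst
  refine ⟨p, fun z hz => ?_⟩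
  have h0 := hp 0 z hz
  have h1 := hp 1 z hz
  have h2 := hp 2 z hz
  ext k
  fin_cases k
  · simp [nilMul] at h0 ⊢
    linarith
  · simp [nilMul] at h1 ⊢
    linarith
  · simp [nilMul] at h0 h1 h2 ⊢
    rw [← h0, ← h1, ← h2]
    ring

/-! ### Dual surfaces -/

/-- Near `z₀` the quotient `c / c z₀` stays in the slit plane, so half its principal logarithm is
smooth; a fixed root `u` of `c z₀` supplies the constant. -/
theorem exists_smooth_sqrt {S : Set ℂ} (hS : IsOpen S) {c : ℂ → ℂ} (hc : ContDiffOn ℝ ∞ c S)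
    {z₀ : ℂ} (hz₀ : z₀ ∈ S) (h0 : c z₀ ≠ 0) :
    ∃ W : Set ℂ, IsOpen W ∧ z₀ ∈ W ∧ W ⊆ S ∧ ∃ ρ : ℂ → ℂ, ContDiffOn ℝ ∞ ρ W ∧
      ∀ z ∈ W, ρ z ^ 2 = c z := by
  obtain ⟨u, hu⟩ := IsAlgClosed.exists_pow_nat_eq (c z₀) (n := 2) (by norm_num)
  have hq : ContDiffOn ℝ ∞ (fun z => c z / c z₀) S := hc.div_const _
  refine ⟨S ∩ (fun z => c z / c z₀) ⁻¹' Complex.slitPlane,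
    hq.continuousOn.isOpen_inter_preimage hS Complex.isOpen_slitPlane, ⟨hz₀, ?_⟩,
    Set.inter_subset_left, fun z => u * Complex.exp (Complex.log (c z / c z₀) / 2), ?_, ?_⟩
  · simp [div_self h0]
  · intro z hz
    have h1 : ContDiffAt ℝ ∞ Complex.log (c z / c z₀) :=
      (Complex.contDiffAt_log hz.2).restrict_scalars ℝ
    have h2 : ContDiffAt ℝ ∞ (fun ζ => c ζ / c z₀) z := hq.contDiffAt (hS.mem_nhds hz.1)
    have h3 : ContDiffAt ℝ ∞ (fun ζ => Complex.log (c ζ / c z₀)) z :=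
      ContDiffAt.comp (g := Complex.log) z h1 h2
    exact (contDiffAt_const.mul (h3.div_const 2).cexp).contDiffWithinAt
  · intro z hz
    have hne : c z / c z₀ ≠ 0 := Complex.slitPlane_ne_zero hz.2
    rw [mul_pow, hu, ← Complex.exp_nat_mul]
    have : ((2 : ℕ) : ℂ) * (Complex.log (c z / c z₀) / 2) = Complex.log (c z / c z₀) := by
      push_cast
      ring
    rw [this, Complex.exp_log hne]
    field_simp

/-- The vector is a quadratic form in `(x, ȳ)`, and both of these are scaled by `ρ`. Thus a factor
`c` is absorbed into the spinors through a square root. -/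
theorem spinorVec_mul_conj_mul (ρ x y : ℂ) :
    spinorVec (ρ * x) (conj ρ * y) = ρ ^ 2 • spinorVec x y := by
  ext k
  fin_cases k <;> simp [spinorVec] <;> ring

/-- The expression is a Wronskian of `x` and `ȳ`; a common factor `ρ` comes out squared and its
derivative drops out. -/
theorem abreschRosenberg_mul_conj_mul {ρ x y : ℂ → ℂ} {z : ℂ} (hρ : DifferentiableAt ℝ ρ z)
    (hx : DifferentiableAt ℝ x z) (hy : DifferentiableAt ℝ y z) :
    abreschRosenberg (fun ζ => ρ ζ * x ζ) (fun ζ => conj (ρ ζ) * y ζ) z =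
      ρ z ^ 2 * (x z * dz (fun ζ => conj (y ζ)) z - conj (y z) * dz x z) / 2 := by
  have Wρ := HasW.of_differentiableAt hρ
  have Wx := HasW.of_differentiableAt hx
  have Wy := (HasW.of_differentiableAt hy).star
  have h1 : HasW (fun ζ => conj (conj (ρ ζ) * y ζ)) z _ _ :=
    (Wρ.mul Wy).congr_fun (Filter.Eventually.of_forall fun ζ => by simp)
  unfold abreschRosenberg
  rw [h1.dz_eq, (Wρ.mul Wx).dz_eq, Wy.dz_eq]
  simp
  ring

/-- With `ρ² = c` the spinors are `ρx`, `ρ̄y`, the support function is `2|ρ|²` and `s² = -ρ²w/2` for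
the Wronskian `w` of `x` and `ȳ`. The dual spinors are `κy`, `κ̄x` with `κ = 4sρ̄ / (2|ρ|²)`, and
`κ² = 4s²/ρ² = -2w`: the factor `c` has disappeared. -/
theorem isDualSurface_of_spinors {Ω : Set ℂ} (hΩ : IsOpen Ω) {f fs : ℂ → Nil} {c x y : ℂ → ℂ}
    (hc : ContDiffOn ℝ ∞ c Ω) (hx : ContDiffOn ℝ ∞ x Ω) (hy : ContDiffOn ℝ ∞ y Ω)
    (hc0 : ∀ z ∈ Ω, c z ≠ 0) (hnorm : ∀ z ∈ Ω, ‖x z‖ ^ 2 + ‖y z‖ ^ 2 = 1)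
    (hf : ∀ z ∈ Ω, mcz f z = c z • spinorVec (x z) (y z))
    (hfs : ∀ z ∈ Ω, mcz fs z = (-2 * (x z * dz (fun ζ => conj (y ζ)) z - conj (y z) * dz x z)) •
      spinorVec (y z) (x z)) : IsDualSurface Ω f fs := by
  intro z₀ hz₀
  obtain ⟨W, hW, hzW, hWΩ, ρ, hρ, hρc⟩ := exists_smooth_sqrt hΩ hc hz₀ (hc0 z₀ hz₀)
  have hρ0 : ∀ z ∈ W, ρ z ≠ 0 := by
    intro z hz h0
    have := hρc z hz
    rw [h0] at this
    exact hc0 z (hWΩ hz) (by rw [← this]; norm_num)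
  have hsupp : ∀ z ∈ W, supportFn (fun ζ => ρ ζ * x ζ) (fun ζ => conj (ρ ζ) * y ζ) z =
      2 * ‖ρ z‖ ^ 2 := by
    intro z hz
    simp only [supportFn, norm_mul, RCLike.norm_conj]
    linear_combination 2 * ‖ρ z‖ ^ 2 * hnorm z (hWΩ hz)
  have hsq : ∀ w : ℂ, ∃ s : ℂ, s ^ 2 = w := fun w =>
    IsAlgClosed.exists_pow_nat_eq w (n := 2) (by norm_num)
  choose sq hsq using hsq
  refine ⟨W, hW, hzW, hWΩ, fun ζ => ρ ζ * x ζ, fun ζ => conj (ρ ζ) * y ζ,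
    fun z => sq (-abreschRosenberg (fun ζ => ρ ζ * x ζ) (fun ζ => conj (ρ ζ) * y ζ) z),
    ⟨hρ.mul (hx.mono hWΩ), (contDiffOn_conj hρ).mul (hy.mono hWΩ), fun z hz => ?_⟩,
    fun z hz => ?_, fun z _ => hsq _, fun z hz => ?_⟩
  · rw [spinorVec_mul_conj_mul, hρc z hz, hf z (hWΩ hz)]
  · rw [hsupp z hz]
    have := norm_pos_iff.2 (hρ0 z hz)
    positivity
  · rw [hfs z (hWΩ hz), hsupp z hz]
    have hs := hsq (-abreschRosenberg (fun ζ => ρ ζ * x ζ) (fun ζ => conj (ρ ζ) * y ζ) z)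
    set s := sq (-abreschRosenberg (fun ζ => ρ ζ * x ζ) (fun ζ => conj (ρ ζ) * y ζ) z)
    rw [abreschRosenberg_mul_conj_mul (differentiableAt_of_smooth hW hρ hz)
      (differentiableAt_of_smooth hΩ hx (hWΩ hz))
      (differentiableAt_of_smooth hΩ hy (hWΩ hz))] at hs
    set w := x z * dz (fun ζ => conj (y ζ)) z - conj (y z) * dz x z
    -- Both dual spinors are brought to the form `κ * y`, `conj κ * x`, so that only `κ²` remains to
    -- be computed.
    have e1 : 4 * s / ((2 * ‖ρ z‖ ^ 2 : ℝ) : ℂ) * (conj (ρ z) * y z) =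
        (4 * s / ((2 * ‖ρ z‖ ^ 2 : ℝ) : ℂ) * conj (ρ z)) * y z := by ring
    have e2 : 4 * conj s / ((2 * ‖ρ z‖ ^ 2 : ℝ) : ℂ) * (ρ z * x z) =
        conj (4 * s / ((2 * ‖ρ z‖ ^ 2 : ℝ) : ℂ) * conj (ρ z)) * x z := by
      have h4 : (starRingEnd ℂ) 4 = 4 := Complex.conj_ofNat 4
      rw [map_mul, map_div₀, map_mul, h4, Complex.conj_ofReal, Complex.conj_conj]
      ring
    rw [e1, e2, spinorVec_mul_conj_mul]
    congr 1
    have hn : (‖ρ z‖ : ℂ) ≠ 0 := by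
      exact_mod_cast norm_ne_zero_iff.2 (hρ0 z hz)
    have hρn : ρ z * conj (ρ z) = (‖ρ z‖ : ℂ) ^ 2 := Complex.mul_conj' _
    push_cast
    field_simp
    have h5 : (‖ρ z‖ : ℂ) ^ 4 = (ρ z) ^ 2 * conj (ρ z) ^ 2 := by
      linear_combination (-(‖ρ z‖ : ℂ) ^ 2 - ρ z * conj (ρ z)) * hρn
    rw [hs, h5]
    ring

/-! ### The normal Gauss map -/

/-- The left-translated unit normal of a surface given by multiples of the spinors `x, y`, where
`|x|² + |y|² = 1`. -/
def spinorNormal (x y : ℂ) : Nil :=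
  ![2 * (x * y).im / (‖x‖ ^ 2 - ‖y‖ ^ 2), -2 * (x * y).re / (‖x‖ ^ 2 - ‖y‖ ^ 2),
    -1 / (‖x‖ ^ 2 - ‖y‖ ^ 2)]

theorem lip_spinorNormal {x y : ℂ} (h1 : ‖x‖ ^ 2 + ‖y‖ ^ 2 = 1) (h2 : ‖x‖ ≠ ‖y‖) :
    lip (spinorNormal x y) (spinorNormal x y) = -1 := by
  have hd : ‖x‖ ^ 2 - ‖y‖ ^ 2 ≠ 0 := by
    rw [sub_ne_zero]
    intro he
    exact h2 ((sq_eq_sq₀ (norm_nonneg _) (norm_nonneg _)).1 he)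
  have h3 : (x * y).re ^ 2 + (x * y).im ^ 2 = ‖x‖ ^ 2 * ‖y‖ ^ 2 := by
    rw [← mul_pow, ← norm_mul, ← Complex.normSq_eq_norm_sq, Complex.normSq_apply]
    ring
  simp only [lip, spinorNormal, Matrix.cons_val]
  field_simp
  linear_combination 4 * h3 + (‖x‖ ^ 2 + ‖y‖ ^ 2 + 1) * h1

/-- Up to the factor `1 / (|x|² - |y|²)` the normal depends only on the product `x * y`, so
exchanging `x` and `y` merely reverses its sign. This is why `f_-` and `f_+` share one normal. -/
theorem lip_mc_spinorNormal {f : ℂ → Nil} {z c x y : ℂ} (h1 : ‖x‖ ^ 2 + ‖y‖ ^ 2 = 1)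
    (h : mcz f z = c • spinorVec x y ∨ mcz f z = c • spinorVec y x) (v : ℂ) :
    lip (mc f z v) (spinorNormal x y) = 0 := by
  have h1' : x * conj x + y * conj y = 1 := by
    rw [Complex.mul_conj', Complex.mul_conj']
    exact_mod_cast h1
  have him : ((x * y).im : ℂ) = -Complex.I * (x * y - conj (x * y)) / 2 := by
    rw [Complex.im_eq_sub_conj]
    rw [div_eq_div_iff (by simp) (by norm_num)]
    linear_combination 2 * (x * y - conj (x * y)) * Complex.I_sq
  have h4 : mc f z v 0 * (2 * (x * y).im) + mc f z v 1 * (-2 * (x * y).re) + mc f z v 2 = 0 := by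
    simp only [mc_eq_mcz]
    apply Complex.ofReal_injective
    push_cast
    rw [him]
    simp only [Complex.re_eq_add_conj]
    have h5 : (starRingEnd ℂ) 2 = 2 := Complex.conj_ofNat 2
    rcases h with h | h
    all_goals
      rw [h]
      simp [spinorVec, h5]
    · linear_combination (-Complex.I * 2 * (c * v * x * conj y - conj c * conj v * conj x * y)) * h1'
    · linear_combination (-Complex.I * 2 * (c * v * y * conj x - conj c * conj v * conj y * x)) * h1'
  simp only [lip, spinorNormal, Matrix.cons_val]
  linear_combination h4 / (‖x‖ ^ 2 - ‖y‖ ^ 2)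

/-- With `d = |x|² - |y|²`, both projections equal `2xy / (1 - d)`, and both are infinite exactly
when `d = 1`. -/
theorem sphereProj_eq_hypProj {x y : ℂ} (h2 : ‖x‖ ≠ ‖y‖) :
    sphereProj ![2 * (x * y).re, 2 * (x * y).im, ‖x‖ ^ 2 - ‖y‖ ^ 2] =
      hypProj (spinorNormal x y) := by
  have hd : ‖x‖ ^ 2 - ‖y‖ ^ 2 ≠ 0 := by
    rw [sub_ne_zero]
    intro he
    exact h2 ((sq_eq_sq₀ (norm_nonneg _) (norm_nonneg _)).1 he)
  unfold sphereProj hypProj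
  by_cases h3 : ‖x‖ ^ 2 - ‖y‖ ^ 2 = 1
  · simp [spinorNormal, h3]
  · have h4 : -1 / (‖x‖ ^ 2 - ‖y‖ ^ 2) ≠ -1 := by
      intro h5
      rw [div_eq_iff hd] at h5
      exact h3 (by linarith)
    rw [if_neg (show ¬(![2 * (x * y).re, 2 * (x * y).im, ‖x‖ ^ 2 - ‖y‖ ^ 2] : Nil) 2 = 1 from h3),
      if_neg (show ¬spinorNormal x y 2 = -1 from h4)]
    simp only [spinorNormal, Matrix.cons_val]
    congr 1
    set d := ‖x‖ ^ 2 - ‖y‖ ^ 2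
    have hd' : (d : ℂ) ≠ 0 := by exact_mod_cast hd
    have h6 : (1 : ℂ) - d ≠ 0 := by
      rw [sub_ne_zero]
      exact_mod_cast (Ne.symm h3)
    have h7 : (1 : ℂ) + ((-1 / d : ℝ) : ℂ) ≠ 0 := by
      intro h8
      have h9 : 1 + -1 / d = 0 := by exact_mod_cast h8
      exact h4 (by linarith)
    rw [div_eq_div_iff h6 h7]
    push_cast
    field_simp
    linear_combination ((x * y).re) * (d - 1) * Complex.I_sq

theorem contDiffOn_spinorNormal {S : Set ℂ} {x y : ℂ → ℂ} (hx : ContDiffOn ℝ ∞ x S)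
    (hy : ContDiffOn ℝ ∞ y S) (h : ∀ z ∈ S, ‖x z‖ ≠ ‖y z‖) :
    ContDiffOn ℝ ∞ (fun z => spinorNormal (x z) (y z)) S := by
  have hd : ContDiffOn ℝ ∞ (fun z => ‖x z‖ ^ 2 - ‖y z‖ ^ 2) S := (hx.norm_sq ℝ).sub (hy.norm_sq ℝ)
  have hd0 : ∀ z ∈ S, ‖x z‖ ^ 2 - ‖y z‖ ^ 2 ≠ 0 := by
    intro z hz
    rw [sub_ne_zero]
    intro he
    exact h z hz ((sq_eq_sq₀ (norm_nonneg _) (norm_nonneg _)).1 he)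
  have hre : ContDiffOn ℝ ∞ (fun z => (x z * y z).re) S :=
    Complex.reCLM.contDiff.comp_contDiffOn (hx.mul hy)
  have him : ContDiffOn ℝ ∞ (fun z => (x z * y z).im) S :=
    Complex.imCLM.contDiff.comp_contDiffOn (hx.mul hy)
  rw [contDiffOn_pi]
  intro k
  fin_cases k
  · exact (contDiffOn_const.mul him).div hd hd0
  · exact (contDiffOn_const.mul hre).div hd hd0
  · exact contDiffOn_const.div hd hd0

/-! ### The Sym formula in terms of the first row of the frame -/

/-- The coordinate `λ = e^{it}` on the circle. -/
def circ (t : ℝ) : ℂ := (Circle.exp t : ℂ)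

theorem circ_mul_conj (t : ℝ) : circ t * conj (circ t) = 1 := by
  rw [Complex.mul_conj']
  simp [circ]

theorem hasDerivAt_circ (t : ℝ) : HasDerivAt circ (Complex.I * circ t) t := by
  have h1 : HasDerivAt (fun s : ℝ => Complex.exp (s * Complex.I)) _ t :=
    ((Complex.ofRealCLM.hasDerivAt (x := t)).mul_const Complex.I).cexp
  have h2 : circ = fun s : ℝ => Complex.exp (s * Complex.I) := by
    funext s
    simp [circ]
  rw [h2]
  convert h1 using 1
  simp
  ring

theorem hasDerivAt_conj {g : ℝ → ℂ} {g' : ℂ} {t : ℝ} (h : HasDerivAt g g' t) :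
    HasDerivAt (fun s => conj (g s)) (conj g') t :=
  h.star

/-- The functions `a = F₁₁`, `b = F₁₂` of `z` and `t`, `λ = e^{it}`, form the first row of an
`SU₂`-valued solution of the equations of an extended frame, with Dirac potential `P`, with
`p = P_z / (2P)`, and with `Q = B / P`. -/
structure IsFrameRow (D : Set ℂ) (P p Q : ℂ → ℂ) (a b : ℂ → ℝ → ℂ) : Prop where
  smooth_a : ContDiffOn ℝ ∞ (fun q : ℂ × ℝ => a q.1 q.2) (D ×ˢ Set.univ)
  smooth_b : ContDiffOn ℝ ∞ (fun q : ℂ × ℝ => b q.1 q.2) (D ×ˢ Set.univ)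
  smooth_Q : ContDiffOn ℝ ∞ Q D
  conj_P : ∀ z, conj (P z) = P z
  norm_eq : ∀ z ∈ D, ∀ t, a z t * conj (a z t) + b z t * conj (b z t) = 1
  hasW_P : ∀ z ∈ D, HasW P z (2 * P z * p z) (2 * P z * conj (p z))
  hasW_Q : ∀ z ∈ D, HasW Q z (dz Q z) (-2 * Q z * conj (p z))
  hasW_a : ∀ z ∈ D, ∀ t, HasW (fun ζ => a ζ t) z (a z t * p z + b z t * conj (circ t) * Q z)
    (-(a z t * conj (p z)) + b z t * circ t * P z)
  hasW_b : ∀ z ∈ D, ∀ t, HasW (fun ζ => b ζ t) z (-(a z t * conj (circ t) * P z) - b z t * p z)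
    (-(a z t * circ t * conj (Q z)) + b z t * conj (p z))

/-- The entry `(1, 2)` of the matrix `m_±` in terms of the first row of the frame. -/
def offEntry (ε : ℂ) (a b : ℂ → ℝ → ℂ) (z : ℂ) (t : ℝ) : ℂ :=
  ε * (a z t * deriv (b z) t - deriv (a z) t * b z t) + Complex.I * a z t * b z t

/-- The entry `(1, 1)` of the matrix `m_±` in terms of the first row of the frame. -/
def diagEntry (ε : ℂ) (a b : ℂ → ℝ → ℂ) (z : ℂ) (t : ℝ) : ℂ :=
  ε * (deriv (a z) t * conj (a z t) + deriv (b z) t * conj (b z t)) -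
    Complex.I / 2 * (a z t * conj (a z t) - b z t * conj (b z t))

/-- The surface `f_±^λ` in terms of the first row of the frame. -/
def rowSurface (ε : ℂ) (a b : ℂ → ℝ → ℂ) (t : ℝ) (z : ℂ) : Nil :=
  ![(2 * Complex.I * offEntry ε a b z t).re, (2 * offEntry ε a b z t).re,
    (-Complex.I * ε * deriv (diagEntry ε a b z) t).re]

namespace IsFrameRow

variable {D : Set ℂ} {P p Q : ℂ → ℂ} {a b : ℂ → ℝ → ℂ}

theorem hasDerivAt_a (h : IsFrameRow D P p Q a b) (hD : IsOpen D) {z : ℂ} (hz : z ∈ D) (t : ℝ) :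
    HasDerivAt (a z) (deriv (a z) t) t :=
  ((contDiffOn_deriv_snd hD h.smooth_a).2 z hz t).differentiableAt.hasDerivAt

theorem hasDerivAt_b (h : IsFrameRow D P p Q a b) (hD : IsOpen D) {z : ℂ} (hz : z ∈ D) (t : ℝ) :
    HasDerivAt (b z) (deriv (b z) t) t :=
  ((contDiffOn_deriv_snd hD h.smooth_b).2 z hz t).differentiableAt.hasDerivAt

/-- This is the `t`-derivative of the frame equation for `a`; the terms without `deriv` come from
`∂_t λ = iλ`. -/
theorem hasW_deriv_a (h : IsFrameRow D P p Q a b) (hD : IsOpen D) {z : ℂ} (hz : z ∈ D) (t : ℝ) :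
    HasW (fun ζ => deriv (a ζ) t) z
      (deriv (a z) t * p z + deriv (b z) t * conj (circ t) * Q z
        - Complex.I * b z t * conj (circ t) * Q z)
      (-(deriv (a z) t * conj (p z)) + deriv (b z) t * circ t * P z
        + Complex.I * b z t * circ t * P z) := by
  have ha := h.hasDerivAt_a hD hz t
  have hb := h.hasDerivAt_b hD hz t
  have hc := hasDerivAt_circ t
  have hc' := hasDerivAt_conj hc
  refine (HasW.deriv_param hD h.smooth_a hz (fun s => h.hasW_a z hz s)
    ((ha.mul_const (p z)).add ((hb.mul hc').mul_const (Q z)))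
    ((ha.mul_const (conj (p z))).neg.add ((hb.mul hc).mul_const (P z)))).congr ?_ ?_
  · simp
    ring
  · ring

theorem hasW_deriv_b (h : IsFrameRow D P p Q a b) (hD : IsOpen D) {z : ℂ} (hz : z ∈ D) (t : ℝ) :
    HasW (fun ζ => deriv (b ζ) t) z
      (-(deriv (a z) t * conj (circ t) * P z) + Complex.I * a z t * conj (circ t) * P z
        - deriv (b z) t * p z)
      (-(deriv (a z) t * circ t * conj (Q z)) - Complex.I * a z t * circ t * conj (Q z)
        + deriv (b z) t * conj (p z)) := by
  have ha := h.hasDerivAt_a hD hz t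
  have hb := h.hasDerivAt_b hD hz t
  have hc := hasDerivAt_circ t
  have hc' := hasDerivAt_conj hc
  refine (HasW.deriv_param hD h.smooth_b hz (fun s => h.hasW_b z hz s)
    (((ha.mul hc').mul_const (P z)).neg.sub (hb.mul_const (p z)))
    (((ha.mul hc).mul_const (conj (Q z))).neg.add (hb.mul_const (conj (p z))))).congr ?_ ?_
  · simp
    ring
  · ring

/-- The point is what is absent: the terms in `p` and in `∂_t a`, `∂_t b` cancel. For each of the
signs `ε = ±1` only one of the potentials `P`, `Q` survives, which separates the two surfaces. -/
theorem hasW_offEntry (h : IsFrameRow D P p Q a b) (hD : IsOpen D) {z : ℂ} (hz : z ∈ D) (t : ℝ)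
    (ε : ℂ) : HasW (fun ζ => offEntry ε a b ζ t) z
      (Complex.I * (ε - 1) * P z * conj (circ t) * a z t ^ 2 +
        Complex.I * (ε + 1) * Q z * conj (circ t) * b z t ^ 2)
      (-(Complex.I * (ε - 1) * P z * circ t * b z t ^ 2) -
        Complex.I * (ε + 1) * conj (Q z) * circ t * a z t ^ 2) := by
  have ha := h.hasW_a z hz t
  have hb := h.hasW_b z hz t
  refine (((((ha.mul (h.hasW_deriv_b hD hz t)).sub ((h.hasW_deriv_a hD hz t).mul hb)).const_mul
    ε).add ((ha.const_mul Complex.I).mul hb))).congr ?_ ?_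
  · ring
  · ring

theorem hasW_diagEntry (h : IsFrameRow D P p Q a b) (hD : IsOpen D) {z : ℂ} (hz : z ∈ D) (t : ℝ)
    (ε : ℂ) : HasW (fun ζ => diagEntry ε a b ζ t) z
      (Complex.I * (ε - 1) * P z * conj (circ t) * a z t * conj (b z t) -
        Complex.I * (ε + 1) * Q z * conj (circ t) * conj (a z t) * b z t)
      (-(Complex.I * (ε + 1) * conj (Q z) * circ t * a z t * conj (b z t)) +
        Complex.I * (ε - 1) * P z * circ t * conj (a z t) * b z t) := by
  have ha := h.hasW_a z hz t
  have hb := h.hasW_b z hz t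
  have hP := h.conj_P z
  refine (((((h.hasW_deriv_a hD hz t).mul ha.star).add ((h.hasW_deriv_b hD hz t).mul
    hb.star)).const_mul ε).sub (((ha.mul ha.star).sub (hb.mul hb.star)).const_mul
    (Complex.I / 2))).congr ?_ ?_
  · simp [hP]
    ring
  · simp [hP]
    ring

theorem contDiffOn_offEntry (h : IsFrameRow D P p Q a b) (hD : IsOpen D) (ε : ℂ) :
    ContDiffOn ℝ ∞ (fun q : ℂ × ℝ => offEntry ε a b q.1 q.2) (D ×ˢ Set.univ) :=
  (contDiffOn_const.mul ((h.smooth_a.mul (contDiffOn_deriv_snd hD h.smooth_b).1).sub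
    ((contDiffOn_deriv_snd hD h.smooth_a).1.mul h.smooth_b))).add
    ((contDiffOn_const.mul h.smooth_a).mul h.smooth_b)

theorem contDiffOn_diagEntry (h : IsFrameRow D P p Q a b) (hD : IsOpen D) (ε : ℂ) :
    ContDiffOn ℝ ∞ (fun q : ℂ × ℝ => diagEntry ε a b q.1 q.2) (D ×ˢ Set.univ) := by
  have ha := h.smooth_a
  have hb := h.smooth_b
  exact (contDiffOn_const.mul (((contDiffOn_deriv_snd hD ha).1.mul (contDiffOn_conj ha)).add
    ((contDiffOn_deriv_snd hD hb).1.mul (contDiffOn_conj hb)))).sub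
    (contDiffOn_const.mul ((ha.mul (contDiffOn_conj ha)).sub (hb.mul (contDiffOn_conj hb))))

theorem hasW_deriv_diagEntry (h : IsFrameRow D P p Q a b) (hD : IsOpen D) {z : ℂ} (hz : z ∈ D)
    (t : ℝ) (ε : ℂ) : HasW (fun ζ => deriv (diagEntry ε a b ζ) t) z
      (Complex.I * (ε - 1) * P z * conj (circ t) * (deriv (a z) t * conj (b z t) +
          a z t * conj (deriv (b z) t) - Complex.I * a z t * conj (b z t)) -
        Complex.I * (ε + 1) * Q z * conj (circ t) * (conj (deriv (a z) t) * b z t +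
          conj (a z t) * deriv (b z) t - Complex.I * conj (a z t) * b z t))
      (-(Complex.I * (ε + 1) * conj (Q z) * circ t * (deriv (a z) t * conj (b z t) +
          a z t * conj (deriv (b z) t) + Complex.I * a z t * conj (b z t))) +
        Complex.I * (ε - 1) * P z * circ t * (conj (deriv (a z) t) * b z t +
          conj (a z t) * deriv (b z) t + Complex.I * conj (a z t) * b z t)) := by
  have ha := h.hasDerivAt_a hD hz t
  have hb := h.hasDerivAt_b hD hz t
  have hc := hasDerivAt_circ t
  have hc' := hasDerivAt_conj hc
  have ha' := hasDerivAt_conj ha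
  have hb' := hasDerivAt_conj hb
  refine (HasW.deriv_param hD (h.contDiffOn_diagEntry hD ε) hz
    (fun s => h.hasW_diagEntry hD hz s ε)
    ((((hc'.const_mul _).mul ha).mul hb').sub (((hc'.const_mul _).mul ha').mul hb))
    ((((hc.const_mul _).mul ha).mul hb').neg.add
      (((hc.const_mul _).mul ha').mul hb))).congr ?_ ?_
  · simp
    ring
  · simp only [Pi.mul_apply]
    ring

/-- Derivative in `t` of `|a|² + |b|² = 1`. It makes `∂_t F F⁻¹` trace-free and is needed in the
third coordinate of the Maurer-Cartan form. -/
theorem norm_deriv (h : IsFrameRow D P p Q a b) (hD : IsOpen D) {z : ℂ} (hz : z ∈ D) (t : ℝ) :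
    deriv (a z) t * conj (a z t) + a z t * conj (deriv (a z) t) +
      deriv (b z) t * conj (b z t) + b z t * conj (deriv (b z) t) = 0 := by
  have ha := h.hasDerivAt_a hD hz t
  have hb := h.hasDerivAt_b hD hz t
  have h1 := (ha.mul (hasDerivAt_conj ha)).add (hb.mul (hasDerivAt_conj hb))
  have h2 : (a z * (fun s => conj (a z s)) + b z * fun s => conj (b z s)) = fun _ => 1 := by
    funext s
    exact h.norm_eq z hz s
  rw [h2] at h1
  have h3 := h1.unique (hasDerivAt_const t 1)
  linear_combination h3

theorem contDiffOn_rowSurface (h : IsFrameRow D P p Q a b) (hD : IsOpen D) (ε : ℂ) (t : ℝ) :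
    ContDiffOn ℝ ∞ (rowSurface ε a b t) D := by
  have slice : ∀ {g : ℂ × ℝ → ℂ}, ContDiffOn ℝ ∞ g (D ×ˢ Set.univ) →
      ContDiffOn ℝ ∞ (fun z => g (z, t)) D := fun hg =>
    hg.comp (contDiff_prodMk_left t).contDiffOn fun z hz => ⟨hz, trivial⟩
  have h1 := slice (h.contDiffOn_offEntry hD ε)
  have h2 := slice (contDiffOn_deriv_snd hD (h.contDiffOn_diagEntry hD ε)).1
  rw [contDiffOn_pi]
  intro k
  fin_cases k
  · exact Complex.reCLM.contDiff.comp_contDiffOn (contDiffOn_const.mul h1)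
  · exact Complex.reCLM.contDiff.comp_contDiffOn (contDiffOn_const.mul h1)
  · exact Complex.reCLM.contDiff.comp_contDiffOn (contDiffOn_const.mul h2)

end IsFrameRow

theorem fderiv_of_hasW {f : ℂ → Nil} {u : Fin 3 → ℂ → ℂ} {α β : Fin 3 → ℂ} {z : ℂ}
    (hf : ∀ ζ k, f ζ k = (u k ζ).re) (hu : ∀ k, HasW (u k) z (α k) (β k)) (v : ℂ) (k : Fin 3) :
    fderiv ℝ f z v k = (α k * v + β k * conj v).re := by
  have hk : ∀ k, HasFDerivAt (fun ζ => f ζ k) (Complex.reCLM.comp (fderiv ℝ (u k) z)) z := by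
    intro k
    have h4 := (Complex.reCLM.hasFDerivAt (x := u k z)).comp z
      (hu k).differentiableAt.hasFDerivAt
    exact h4.congr_of_eventuallyEq (Filter.Eventually.of_forall fun ζ => hf ζ k)
  rw [(hasFDerivAt_pi.2 hk).fderiv]
  simp only [ContinuousLinearMap.coe_pi', ContinuousLinearMap.comp_apply, (hu k).fderiv_apply]
  simp

/-! ### Maurer-Cartan form and harmonicity of the surfaces built from the first row -/

namespace IsFrameRow

variable {D : Set ℂ} {P p Q : ℂ → ℂ} {a b : ℂ → ℝ → ℂ}

theorem fderiv_rowSurface (h : IsFrameRow D P p Q a b) (hD : IsOpen D) {z : ℂ} (hz : z ∈ D)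
    (t : ℝ) (ε v : ℂ) :
    fderiv ℝ (rowSurface ε a b t) z v 0 = (2 * Complex.I *
      (dz (fun ζ => offEntry ε a b ζ t) z * v + dzbar (fun ζ => offEntry ε a b ζ t) z * conj v)).re ∧
    fderiv ℝ (rowSurface ε a b t) z v 1 = (2 *
      (dz (fun ζ => offEntry ε a b ζ t) z * v + dzbar (fun ζ => offEntry ε a b ζ t) z * conj v)).re ∧
    fderiv ℝ (rowSurface ε a b t) z v 2 = (-Complex.I * ε *
      (dz (fun ζ => deriv (diagEntry ε a b ζ) t) z * v +
        dzbar (fun ζ => deriv (diagEntry ε a b ζ) t) z * conj v)).re := by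
  have ho := h.hasW_offEntry hD hz t ε
  have hd := h.hasW_deriv_diagEntry hD hz t ε
  rw [ho.dz_eq, ho.dzbar_eq, hd.dz_eq, hd.dzbar_eq]
  have h0 := ho.const_mul (2 * Complex.I)
  have h1 := ho.const_mul 2
  have h2 := hd.const_mul (-Complex.I * ε)
  have key := fderiv_of_hasW (f := rowSurface ε a b t)
    (u := ![fun ζ => 2 * Complex.I * offEntry ε a b ζ t, fun ζ => 2 * offEntry ε a b ζ t,
      fun ζ => -Complex.I * ε * deriv (diagEntry ε a b ζ) t]) (z := z)
    (α := ![_, _, _]) (β := ![_, _, _]) (by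
      intro ζ k
      fin_cases k <;> rfl) (by
      intro k
      fin_cases k
      · exact h0
      · exact h1
      · exact h2) v
  refine ⟨(key 0).trans ?_, (key 1).trans ?_, (key 2).trans ?_⟩ <;>
  · simp only [Matrix.cons_val]
    congr 1
    ring

/-- The first two components come directly from the derivative of `offEntry`. In the third, the
terms with `∂_t a`, `∂_t b` from the `t`-derivative of `diagEntry` cancel against the Heisenberg
correction; this uses that the row is a unit vector (`hn`) and the `t`-derivative of that fact
(`hn'`). -/
theorem mc_rowSurface (h : IsFrameRow D P p Q a b) (hD : IsOpen D) {z : ℂ} (hz : z ∈ D)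
    (t : ℝ) {ε : ℂ} (hε : ε = 1 ∨ ε = -1) (v : ℂ) (k : Fin 3) :
    mc (rowSurface ε a b t) z v k =
      2 * (((((ε - 1) * P z * conj (circ t)) • spinorVec (a z t) (b z t) +
        ((ε + 1) * Q z * conj (circ t)) • spinorVec (b z t) (a z t)) k) * v).re := by
  obtain ⟨e0, e1, e2⟩ := h.fderiv_rowSurface hD hz t ε v
  have ho := h.hasW_offEntry hD hz t ε
  have hd := h.hasW_deriv_diagEntry hD hz t ε
  rw [ho.dz_eq, ho.dzbar_eq] at e0 e1
  rw [hd.dz_eq, hd.dzbar_eq] at e2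
  have hP := h.conj_P z
  have hn := h.norm_eq z hz t
  have hn' := h.norm_deriv hD hz t
  have h2 : (starRingEnd ℂ) 2 = 2 := Complex.conj_ofNat 2
  unfold mc leftTranslate
  fin_cases k
  · apply Complex.ofReal_injective
    simp only [Fin.zero_eta, Matrix.cons_val_zero, e0]
    push_cast
    simp only [Complex.re_eq_add_conj]
    rcases hε with rfl | rfl
    all_goals
      simp [spinorVec, hP, h2]
      ring_nf
      simp only [Complex.I_sq]
      ring
  · apply Complex.ofReal_injective
    simp only [Fin.mk_one, Matrix.cons_val_one, Matrix.cons_val_zero, e1]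
    push_cast
    simp only [Complex.re_eq_add_conj]
    rcases hε with rfl | rfl
    all_goals
      simp [spinorVec, hP, h2]
      ring_nf
  · apply Complex.ofReal_injective
    simp only [Fin.reduceFinMk, Matrix.cons_val, e0, e1, e2, rowSurface]
    push_cast
    simp only [Complex.re_eq_add_conj, offEntry]
    have hI := Complex.I_sq
    generalize deriv (a z) t = a' at *
    generalize deriv (b z) t = b' at *
    rcases hε with rfl | rfl
    · simp [spinorVec, h2]
      linear_combination Complex.I * ((-2 * Complex.I * conj (Q z) * circ t * conj v) *
        (a z t * conj b' + a' * conj (b z t) -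
        Complex.I * a z t * conj (b z t)) - (2 * Complex.I * Q z * conj (circ t) * v) *
        (conj (a z t) * b' + conj a' * b z t +
        Complex.I * conj (a z t) * b z t)) * hn -
        Complex.I * ((-2 * Complex.I * conj (Q z) * circ t * conj v) * a z t * conj (b z t) -
        (2 * Complex.I * Q z * conj (circ t) * v) * conj (a z t) * b z t) * hn' +
        4 * Complex.I * (conj (Q z) * circ t * conj (b z t) * a z t * conj v -
        Q z * conj (circ t) * b z t * conj (a z t) * v) * hI
    · simp [spinorVec, hP, h2]
      linear_combination Complex.I * ((-2 * Complex.I * P z * conj (circ t) * v) *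
        (-(a z t * conj b' + a' * conj (b z t)) -
        Complex.I * a z t * conj (b z t)) - (2 * Complex.I * P z * circ t * conj v) *
        (-(conj (a z t) * b' + conj a' * b z t) +
        Complex.I * conj (a z t) * b z t)) * hn +
        Complex.I * ((-2 * Complex.I * P z * conj (circ t) * v) * a z t * conj (b z t) -
        (2 * Complex.I * P z * circ t * conj v) * conj (a z t) * b z t) * hn' +
        4 * Complex.I * (P z * conj (circ t) * conj (b z t) * a z t * v -
        P z * circ t * b z t * conj (a z t) * conj v) * hI

theorem mcz_rowSurface_neg (h : IsFrameRow D P p Q a b) (hD : IsOpen D) {z : ℂ} (hz : z ∈ D)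
    (t : ℝ) : mcz (rowSurface (-1) a b t) z =
      (-2 * P z * conj (circ t)) • spinorVec (a z t) (b z t) := by
  refine mcz_eq_of_mc fun v k => ?_
  rw [h.mc_rowSurface hD hz t (Or.inr rfl)]
  norm_num

theorem mcz_rowSurface_one (h : IsFrameRow D P p Q a b) (hD : IsOpen D) {z : ℂ} (hz : z ∈ D)
    (t : ℝ) : mcz (rowSurface 1 a b t) z =
      (2 * Q z * conj (circ t)) • spinorVec (b z t) (a z t) := by
  refine mcz_eq_of_mc fun v k => ?_
  rw [h.mc_rowSurface hD hz t (Or.inl rfl)]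
  norm_num

/-- In `∂_z̄` of `P a²`, `P b̄²` and `P a b̄` the terms with `p̄` cancel, by `P_z̄ = 2P p̄`. The
rest carries a factor `λ` that meets the prefactor `λ̄`, so harmonicity does not depend on `λ`. -/
theorem isSingularMaximalSurface_neg (h : IsFrameRow D P p Q a b) (hD : IsOpen D) (t : ℝ) :
    IsSingularMaximalSurface D (rowSurface (-1) a b t) where
  smooth := h.contDiffOn_rowSurface hD _ t
  conformal z hz := isConformalAt_of_spinors (h.mcz_rowSurface_neg hD hz t)
  harmonic z hz := by
    have ha := h.hasW_a z hz t
    have hb := h.hasW_b z hz t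
    have hP := h.conj_P z
    have hn := h.norm_eq z hz t
    have hE := circ_mul_conj t
    have h22 : (starRingEnd ℂ) 2 = 2 := Complex.conj_ofNat 2
    have h44 : (starRingEnd ℂ) 4 = 4 := Complex.conj_ofNat 4
    have hc := (h.hasW_P z hz).const_mul (-2 * conj (circ t))
    have hev : ∀ k, (fun ζ => mcz (rowSurface (-1) a b t) ζ k) =ᶠ[𝓝 z]
        fun ζ => -2 * conj (circ t) * P ζ * spinorVec (a ζ t) (b ζ t) k := by
      intro k
      filter_upwards [hD.mem_nhds hz] with ζ hζ
      rw [h.mcz_rowSurface_neg hD hζ t, Pi.smul_apply, smul_eq_mul]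
      ring
    -- These are the `z̄`-derivatives of `φ₁, φ₂, φ₃` after `λλ̄ = 1`. The first two are real and
    -- the third is purely imaginary, as `P` is real.
    refine tension_eq_zero (β := ![4 * P z ^ 2 * (a z t * b z t + conj (a z t) * conj (b z t)),
      -Complex.I * (4 * P z ^ 2 * (a z t * b z t - conj (a z t) * conj (b z t))),
      Complex.I * (4 * P z ^ 2 * ((a z t * conj (a z t) - b z t * conj (b z t))))])
      (fun k => ?_) ?_ ?_ ?_
    · fin_cases k
      · exact ⟨_, ((hc.mul ((hb.star.mul hb.star).sub (ha.mul ha))).congr rfl (by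
          simp [hP]
          linear_combination 4 * P z ^ 2 * (a z t * b z t + conj (a z t) * conj (b z t)) * hE)).congr_fun
            ((hev 0).trans
            (Filter.Eventually.of_forall fun ζ => by simp only [spinorVec, Matrix.cons_val]; ring))⟩
      · exact ⟨_, ((hc.mul (((hb.star.mul hb.star).add (ha.mul ha)).const_mul
          Complex.I)).congr rfl (by
          simp [hP]
          linear_combination -Complex.I * 4 * P z ^ 2 * (a z t * b z t - conj (a z t) * conj (b z t)) * hE)).congr_fun
            ((hev 1).trans
            (Filter.Eventually.of_forall fun ζ => by simp only [spinorVec, Matrix.cons_val]; ring))⟩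
      · exact ⟨_, ((hc.mul ((ha.mul hb.star).const_mul (2 * Complex.I))).congr rfl (by
          simp [hP]
          linear_combination Complex.I * 4 * P z ^ 2 * (a z t * conj (a z t) - b z t * conj (b z t)) * hE)).congr_fun
            ((hev 2).trans
            (Filter.Eventually.of_forall fun ζ => by simp only [spinorVec, Matrix.cons_val]; ring))⟩
    · rw [h.mcz_rowSurface_neg hD hz t]
      apply Complex.ofReal_injective
      simp only [Complex.re_eq_add_conj]
      simp [spinorVec, hP, h22, h44]
      linear_combination -8 * P z ^ 2 * (a z t * b z t + conj (a z t) * conj (b z t)) *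
        ((a z t * conj (a z t) + b z t * conj (b z t)) * hE + hn -
          (a z t * conj (a z t) + b z t * conj (b z t)) * circ t * conj (circ t) * Complex.I_sq)
    · rw [h.mcz_rowSurface_neg hD hz t]
      apply Complex.ofReal_injective
      push_cast
      simp only [Complex.re_eq_add_conj]
      simp [spinorVec, hP, h22, h44]
      linear_combination 4 * Complex.I * P z ^ 2 *
        (a z t * b z t - conj (a z t) * conj (b z t)) *
        ((a z t * conj (a z t) + b z t * conj (b z t)) * hE + hn)
    · apply Complex.ofReal_injective
      simp only [Complex.re_eq_add_conj]
      simp [hP, h44]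
      ring

/-- The same cancellation with `a` and `b` exchanged and `Q` for `P`; it works because `Q_z̄ = -2Q
p̄` and the `p̄`-terms of `a` and `b` have opposite signs. The square `P²` is replaced by `|Q|²`. -/
theorem isSingularMaximalSurface_one (h : IsFrameRow D P p Q a b) (hD : IsOpen D) (t : ℝ) :
    IsSingularMaximalSurface D (rowSurface 1 a b t) where
  smooth := h.contDiffOn_rowSurface hD _ t
  conformal z hz := isConformalAt_of_spinors (h.mcz_rowSurface_one hD hz t)
  harmonic z hz := by
    have ha := h.hasW_a z hz t
    have hb := h.hasW_b z hz t
    have hn := h.norm_eq z hz t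
    have hE := circ_mul_conj t
    have h22 : (starRingEnd ℂ) 2 = 2 := Complex.conj_ofNat 2
    have h44 : (starRingEnd ℂ) 4 = 4 := Complex.conj_ofNat 4
    have hc := (h.hasW_Q z hz).const_mul (2 * conj (circ t))
    have hev : ∀ k, (fun ζ => mcz (rowSurface 1 a b t) ζ k) =ᶠ[𝓝 z]
        fun ζ => 2 * conj (circ t) * Q ζ * spinorVec (b ζ t) (a ζ t) k := by
      intro k
      filter_upwards [hD.mem_nhds hz] with ζ hζ
      rw [h.mcz_rowSurface_one hD hζ t, Pi.smul_apply, smul_eq_mul]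
      ring
    refine tension_eq_zero (β := ![4 * (Q z * conj (Q z)) * (a z t * b z t + conj (a z t) * conj (b z t)),
      -Complex.I * (4 * (Q z * conj (Q z)) * (a z t * b z t - conj (a z t) * conj (b z t))),
      Complex.I * (4 * (Q z * conj (Q z)) * (-(a z t * conj (a z t) - b z t * conj (b z t))))])
      (fun k => ?_) ?_ ?_ ?_
    · fin_cases k
      · exact ⟨_, ((hc.mul ((ha.star.mul ha.star).sub (hb.mul hb))).congr rfl (by
          simp
          linear_combination 4 * (Q z * conj (Q z)) * (a z t * b z t + conj (a z t) * conj (b z t)) * hE)).congr_fun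
            ((hev 0).trans
            (Filter.Eventually.of_forall fun ζ => by simp only [spinorVec, Matrix.cons_val]; ring))⟩
      · exact ⟨_, ((hc.mul (((ha.star.mul ha.star).add (hb.mul hb)).const_mul
          Complex.I)).congr rfl (by
          simp
          linear_combination
            -Complex.I * 4 * (Q z * conj (Q z)) * (a z t * b z t - conj (a z t) * conj (b z t)) * hE)).congr_fun
            ((hev 1).trans
            (Filter.Eventually.of_forall fun ζ => by simp only [spinorVec, Matrix.cons_val]; ring))⟩
      · exact ⟨_, ((hc.mul ((hb.mul ha.star).const_mul (2 * Complex.I))).congr rfl (by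
          simp
          linear_combination
            -Complex.I * 4 * (Q z * conj (Q z)) * (a z t * conj (a z t) - b z t * conj (b z t)) * hE)).congr_fun
            ((hev 2).trans
            (Filter.Eventually.of_forall fun ζ => by simp only [spinorVec, Matrix.cons_val]; ring))⟩
    · rw [h.mcz_rowSurface_one hD hz t]
      apply Complex.ofReal_injective
      simp only [Complex.re_eq_add_conj]
      simp [spinorVec, h22, h44]
      linear_combination -8 * (Q z * conj (Q z)) * (a z t * b z t + conj (a z t) * conj (b z t)) *
        ((a z t * conj (a z t) + b z t * conj (b z t)) * hE + hn -
          (a z t * conj (a z t) + b z t * conj (b z t)) * circ t * conj (circ t) * Complex.I_sq)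
    · rw [h.mcz_rowSurface_one hD hz t]
      apply Complex.ofReal_injective
      push_cast
      simp only [Complex.re_eq_add_conj]
      simp [spinorVec, h22, h44]
      linear_combination 4 * Complex.I * (Q z * conj (Q z)) *
        (a z t * b z t - conj (a z t) * conj (b z t)) *
        ((a z t * conj (a z t) + b z t * conj (b z t)) * hE + hn)
    · apply Complex.ofReal_injective
      simp only [Complex.re_eq_add_conj]
      simp [h44]
      ring

end IsFrameRow

/-! ### Extended frames -/

theorem entries_of_mem_SU {M : Matrix (Fin 2) (Fin 2) ℂ}
    (hM : M ∈ Matrix.specialUnitaryGroup (Fin 2) ℂ) :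
    M 1 0 = -conj (M 0 1) ∧ M 1 1 = conj (M 0 0) ∧
      M 0 0 * conj (M 0 0) + M 0 1 * conj (M 0 1) = 1 ∧
      M⁻¹ = !![conj (M 0 0), -M 0 1; conj (M 0 1), M 0 0] ∧ M * M⁻¹ = 1 := by
  rw [Matrix.mem_specialUnitaryGroup_iff] at hM
  obtain ⟨hU, hdet⟩ := hM
  have h1 : M * star M = 1 := (Matrix.mem_unitaryGroup_iff).1 hU
  have h2 : M⁻¹ = star M := Matrix.inv_eq_right_inv h1
  have h3 : M⁻¹ = !![M 1 1, -M 0 1; -M 1 0, M 0 0] := by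
    rw [Matrix.inv_def, hdet, Matrix.adjugate_fin_two]
    simp
  have h4 : M 1 1 = conj (M 0 0) := by
    have := congrFun (congrFun (h3.symm.trans h2) 0) 0
    simpa [Matrix.star_apply] using this
  have h5 : -M 1 0 = conj (M 0 1) := by
    have := congrFun (congrFun (h3.symm.trans h2) 1) 0
    simpa [Matrix.star_apply] using this
  refine ⟨by rw [← h5, neg_neg], h4, ?_, by rw [h3, h4, h5], by rw [h2, h1]⟩
  rw [Matrix.det_fin_two] at hdet
  rw [← h4, ← h5]
  linear_combination hdet

theorem diracPotential_eq (ψ₁ ψ₂ : ℂ → ℂ) (z : ℂ) : diracPotential ψ₁ ψ₂ z =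
    -(1 / 2) * (ψ₁ z * conj (ψ₁ z) + ψ₂ z * conj (ψ₂ z)) := by
  simp only [diracPotential, supportFn, Complex.mul_conj']
  push_cast
  ring

theorem conj_diracPotential (ψ₁ ψ₂ : ℂ → ℂ) (z : ℂ) :
    conj (diracPotential ψ₁ ψ₂ z) = diracPotential ψ₁ ψ₂ z := by
  have h44 : (starRingEnd ℂ) 4 = 4 := Complex.conj_ofNat 4
  simp [diracPotential, h44]

theorem contDiffOn_diracPotential {D : Set ℂ} {ψ₁ ψ₂ : ℂ → ℂ} (h₁ : ContDiffOn ℝ ∞ ψ₁ D)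
    (h₂ : ContDiffOn ℝ ∞ ψ₂ D) : ContDiffOn ℝ ∞ (diracPotential ψ₁ ψ₂) D :=
  (contDiffOn_const.mul ((h₁.mul (contDiffOn_conj h₁)).add (h₂.mul (contDiffOn_conj h₂)))).congr
    fun z _ => diracPotential_eq ψ₁ ψ₂ z

theorem contDiffOn_abreschRosenberg {D : Set ℂ} (hD : IsOpen D) {ψ₁ ψ₂ : ℂ → ℂ}
    (h₁ : ContDiffOn ℝ ∞ ψ₁ D) (h₂ : ContDiffOn ℝ ∞ ψ₂ D) :
    ContDiffOn ℝ ∞ (abreschRosenberg ψ₁ ψ₂) D :=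
  ((h₁.mul (contDiffOn_dz hD (contDiffOn_conj h₂))).sub
    ((contDiffOn_conj h₂).mul (contDiffOn_dz hD h₁))).div_const 2

namespace IsExtendedFrame

variable {D : Set ℂ} {ψ₁ ψ₂ : ℂ → ℂ} {F : ℂ → Circle → Matrix (Fin 2) (Fin 2) ℂ}

theorem spinors_norm_pos (hF : IsExtendedFrame D ψ₁ ψ₂ F) {z : ℂ} (hz : z ∈ D) :
    0 < ‖ψ₁ z‖ ^ 2 + ‖ψ₂ z‖ ^ 2 := by
  by_contra hcon
  have h0 : ‖ψ₁ z‖ ^ 2 + ‖ψ₂ z‖ ^ 2 = 0 := le_antisymm (not_lt.1 hcon) (by positivity)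
  have h1 := (entries_of_mem_SU (hF.mem_SU z hz 1)).2.2.1
  rw [hF.at_one z hz, h0] at h1
  simp at h1

theorem diracPotential_ne_zero (hF : IsExtendedFrame D ψ₁ ψ₂ F) {z : ℂ} (hz : z ∈ D) :
    diracPotential ψ₁ ψ₂ z ≠ 0 := by
  have h := hF.spinors_norm_pos hz
  have : supportFn ψ₁ ψ₂ z ≠ 0 := by
    unfold supportFn
    positivity
  simpa [diracPotential] using this

theorem hasW_diracPotential (hF : IsExtendedFrame D ψ₁ ψ₂ F) (hD : IsOpen D)
    (h₁ : ContDiffOn ℝ ∞ ψ₁ D) (h₂ : ContDiffOn ℝ ∞ ψ₂ D) {z : ℂ} (hz : z ∈ D) :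
    HasW (diracPotential ψ₁ ψ₂) z
      (2 * diracPotential ψ₁ ψ₂ z *
        (dz (diracPotential ψ₁ ψ₂) z / (2 * diracPotential ψ₁ ψ₂ z)))
      (2 * diracPotential ψ₁ ψ₂ z *
        conj (dz (diracPotential ψ₁ ψ₂) z / (2 * diracPotential ψ₁ ψ₂ z))) := by
  have h0 := hF.diracPotential_ne_zero hz
  have hW := HasW.of_differentiableAt
    (differentiableAt_of_smooth hD (contDiffOn_diracPotential h₁ h₂) hz)
  have hs : HasW (diracPotential ψ₁ ψ₂) z _ _ := hW.star.congr_fun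
    (Filter.Eventually.of_forall fun ζ => (conj_diracPotential ψ₁ ψ₂ ζ).symm)
  have h22 : (starRingEnd ℂ) 2 = 2 := Complex.conj_ofNat 2
  refine hW.congr ?_ ?_
  · field_simp
  · rw [(hW.unique hs).2, map_div₀, map_mul, h22, conj_diracPotential]
    field_simp

/-- The frame equation is rewritten as `F_z = F U`, `F_z̄ = F V`, whose first row is a closed
system. On the circle `λ⁻¹ = λ̄`, and reality of `P` gives `P_z̄ / (2P) = p̄`. -/
theorem hasW_entries (hF : IsExtendedFrame D ψ₁ ψ₂ F) (hD : IsOpen D)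
    (h₁ : ContDiffOn ℝ ∞ ψ₁ D) (h₂ : ContDiffOn ℝ ∞ ψ₂ D) {z : ℂ} (hz : z ∈ D) (t : ℝ) :
    HasW (fun ζ => F ζ (Circle.exp t) 0 0) z
      (F z (Circle.exp t) 0 0 * (dz (diracPotential ψ₁ ψ₂) z / (2 * diracPotential ψ₁ ψ₂ z)) +
        F z (Circle.exp t) 0 1 * conj (circ t) *
          (abreschRosenberg ψ₁ ψ₂ z / diracPotential ψ₁ ψ₂ z))
      (-(F z (Circle.exp t) 0 0 *
          conj (dz (diracPotential ψ₁ ψ₂) z / (2 * diracPotential ψ₁ ψ₂ z))) +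
        F z (Circle.exp t) 0 1 * circ t * diracPotential ψ₁ ψ₂ z) ∧
    HasW (fun ζ => F ζ (Circle.exp t) 0 1) z
      (-(F z (Circle.exp t) 0 0 * conj (circ t) * diracPotential ψ₁ ψ₂ z) -
        F z (Circle.exp t) 0 1 * (dz (diracPotential ψ₁ ψ₂) z / (2 * diracPotential ψ₁ ψ₂ z)))
      (-(F z (Circle.exp t) 0 0 * circ t *
          conj (abreschRosenberg ψ₁ ψ₂ z / diracPotential ψ₁ ψ₂ z)) +
        F z (Circle.exp t) 0 1 *
          conj (dz (diracPotential ψ₁ ψ₂) z / (2 * diracPotential ψ₁ ψ₂ z))) := by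
  have hO : IsOpen (D ×ˢ (Set.univ : Set ℝ)) := hD.prod isOpen_univ
  have hW : ∀ i j, HasW (fun ζ => F ζ (Circle.exp t) i j) z _ _ := fun i j =>
    HasW.of_differentiableAt ((differentiableAt_of_smooth hO (hF.smooth i j)
      (p := (z, t)) ⟨hz, trivial⟩).comp z (f := fun ζ : ℂ => ((ζ, t) : ℂ × ℝ))
      (differentiableAt_id.prodMk (differentiableAt_const t)))
  have hinv := (entries_of_mem_SU (hF.mem_SU z hz (Circle.exp t))).2.2.2.2
  have hU := congrArg (F z (Circle.exp t) * ·) (hF.dz_eq z hz (Circle.exp t))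
  have hV := congrArg (F z (Circle.exp t) * ·) (hF.dzbar_eq z hz (Circle.exp t))
  simp only [← Matrix.mul_assoc, hinv, Matrix.one_mul] at hU hV
  have hc : (circ t)⁻¹ = conj (circ t) := by
    rw [circ, ← Circle.coe_inv_eq_conj, Circle.coe_inv]
  have hc' : ((Circle.exp t : Circle) : ℂ) = circ t := rfl
  have hp : dzbar (diracPotential ψ₁ ψ₂) z / (2 * diracPotential ψ₁ ψ₂ z) =
      conj (dz (diracPotential ψ₁ ψ₂) z / (2 * diracPotential ψ₁ ψ₂ z)) := by
    rw [(hF.hasW_diracPotential hD h₁ h₂ hz).dzbar_eq]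
    have := hF.diracPotential_ne_zero hz
    field_simp
  have hq : conj (abreschRosenberg ψ₁ ψ₂ z) / diracPotential ψ₁ ψ₂ z =
      conj (abreschRosenberg ψ₁ ψ₂ z / diracPotential ψ₁ ψ₂ z) := by
    rw [map_div₀, conj_diracPotential]
  have e1 := congrFun (congrFun hU 0) 0
  have e2 := congrFun (congrFun hU 0) 1
  have e3 := congrFun (congrFun hV 0) 0
  have e4 := congrFun (congrFun hV 0) 1
  simp only [frameU, frameV, Matrix.mul_apply, Fin.sum_univ_two, Matrix.of_apply,
    Matrix.cons_val, hp, hq, hc', hc] at e1 e2 e3 e4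
  exact ⟨(hW 0 0).congr (e1.trans (by ring)) (e3.trans (by ring)),
    (hW 0 1).congr (e2.trans (by ring)) (e4.trans (by ring))⟩

/-- The nonlinear Dirac equation for the generating spinors. -/
theorem dirac_eq (hF : IsExtendedFrame D ψ₁ ψ₂ F) (hD : IsOpen D)
    (h₁ : ContDiffOn ℝ ∞ ψ₁ D) (h₂ : ContDiffOn ℝ ∞ ψ₂ D) {z : ℂ} (hz : z ∈ D) :
    dzbar ψ₁ z = diracPotential ψ₁ ψ₂ z * ψ₂ z ∧
      dz ψ₂ z = -(diracPotential ψ₁ ψ₂ z * ψ₁ z) := by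
  obtain ⟨ha, hb⟩ := hF.hasW_entries hD h₁ h₂ hz 0
  simp only [Circle.exp_zero] at ha hb
  have hc : circ 0 = 1 := by simp [circ]
  rw [hc, map_one] at ha hb
  -- At `λ = 1` the spinors are `r` times the first row. From `r² = -2P` one gets `r_z = r p` and
  -- `r_z̄ = r p̄`, and these cancel the diagonal terms of the frame equation.
  set r : ℂ → ℂ := fun ζ => ((Real.sqrt (‖ψ₁ ζ‖ ^ 2 + ‖ψ₂ ζ‖ ^ 2) : ℝ) : ℂ)
  have hr0 : ∀ ζ ∈ D, r ζ ≠ 0 := fun ζ hζ => by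
    exact Complex.ofReal_ne_zero.2 (Real.sqrt_pos.2 (hF.spinors_norm_pos hζ)).ne'
  have hrd : DifferentiableAt ℝ r z := by
    have hn : ContDiffOn ℝ ∞ (fun ζ => ‖ψ₁ ζ‖ ^ 2 + ‖ψ₂ ζ‖ ^ 2) D :=
      (h₁.norm_sq ℝ).add (h₂.norm_sq ℝ)
    have hs := (differentiableAt_of_smooth hD hn hz).sqrt (hF.spinors_norm_pos hz).ne'
    exact (Complex.ofRealCLM.differentiableAt).comp z hs
  have hr := HasW.of_differentiableAt hrd
  have hrr : HasW (fun ζ => r ζ * r ζ) z _ _ :=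
    ((hF.hasW_diracPotential hD h₁ h₂ hz).const_mul (-2)).congr_fun
      (Filter.Eventually.of_forall fun ζ => by
        simp only [r, ← Complex.ofReal_mul]
        rw [Real.mul_self_sqrt (by positivity), diracPotential_eq, Complex.mul_conj',
          Complex.mul_conj']
        push_cast
        ring)
  obtain ⟨hr1, hr2⟩ := (hr.mul hr).unique hrr
  have hrP : r z * r z = -2 * diracPotential ψ₁ ψ₂ z := by
    simp only [r, ← Complex.ofReal_mul]
    rw [Real.mul_self_sqrt (by positivity), diracPotential_eq, Complex.mul_conj',
      Complex.mul_conj']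
    push_cast
    ring
  generalize dz (diracPotential ψ₁ ψ₂) z / (2 * diracPotential ψ₁ ψ₂ z) = p at *
  have hr1' : dz r z = r z * p := by
    apply mul_left_cancel₀ (mul_ne_zero two_ne_zero (hr0 z hz))
    linear_combination hr1 - 2 * p * hrP
  have hr2' : dzbar r z = r z * conj p := by
    apply mul_left_cancel₀ (mul_ne_zero two_ne_zero (hr0 z hz))
    linear_combination hr2 - 2 * conj p * hrP
  have e1 : ∀ ζ ∈ D, ψ₁ ζ = r ζ * F ζ 1 0 0 := by
    intro ζ hζ
    rw [hF.at_one ζ hζ]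
    simp only [Matrix.smul_apply, Matrix.of_apply, Matrix.cons_val, smul_eq_mul]
    exact (mul_inv_cancel_left₀ (hr0 ζ hζ) _).symm
  have e2 : ∀ ζ ∈ D, ψ₂ ζ = r ζ * F ζ 1 0 1 := by
    intro ζ hζ
    rw [hF.at_one ζ hζ]
    simp only [Matrix.smul_apply, Matrix.of_apply, Matrix.cons_val, smul_eq_mul]
    exact (mul_inv_cancel_left₀ (hr0 ζ hζ) _).symm
  have w1 := (hr.mul ha).congr_fun (Filter.eventually_of_mem (hD.mem_nhds hz) e1)
  have w2 := (hr.mul hb).congr_fun (Filter.eventually_of_mem (hD.mem_nhds hz) e2)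
  rw [w1.dzbar_eq, w2.dz_eq, hr1', hr2', e1 z hz, e2 z hz]
  constructor <;> ring

/-- Commuting the mixed derivatives turns the second derivatives in `B_z̄` into `(Pψ₂)_z` and
`-(Pψ̄₁)_z` by the Dirac equation. The remaining terms cancel because `P = -(|ψ₁|² + |ψ₂|²)/2` and,
again by the Dirac equation, `-2P_z = ψ̄₁ (ψ₁)_z + ψ₂ (ψ̄₂)_z`. -/
theorem dzbar_abreschRosenberg (hF : IsExtendedFrame D ψ₁ ψ₂ F) (hD : IsOpen D)
    (h₁ : ContDiffOn ℝ ∞ ψ₁ D) (h₂ : ContDiffOn ℝ ∞ ψ₂ D) {z : ℂ} (hz : z ∈ D) :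
    dzbar (abreschRosenberg ψ₁ ψ₂) z = 0 := by
  have hd₁ : ∀ ζ ∈ D, HasW ψ₁ ζ (dz ψ₁ ζ) (diracPotential ψ₁ ψ₂ ζ * ψ₂ ζ) := fun ζ hζ =>
    (HasW.of_differentiableAt (differentiableAt_of_smooth hD h₁ hζ)).congr rfl
      (hF.dirac_eq hD h₁ h₂ hζ).1
  have hd₂ : ∀ ζ ∈ D, HasW ψ₂ ζ (-(diracPotential ψ₁ ψ₂ ζ * ψ₁ ζ)) (dzbar ψ₂ ζ) := fun ζ hζ =>
    (HasW.of_differentiableAt (differentiableAt_of_smooth hD h₂ hζ)).congr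
      (hF.dirac_eq hD h₁ h₂ hζ).2 rfl
  have hP := hF.hasW_diracPotential hD h₁ h₂ hz
  have hsum : HasW (diracPotential ψ₁ ψ₂) z _ _ :=
    (((((hd₁ z hz).mul (hd₁ z hz).star).add ((hd₂ z hz).mul (hd₂ z hz).star))).const_mul
      (-(1 / 2))).congr_fun (Filter.Eventually.of_forall fun ζ => diracPotential_eq ψ₁ ψ₂ ζ)
  obtain ⟨hPz, -⟩ := hP.unique hsum
  have hPe := diracPotential_eq ψ₁ ψ₂ z
  have hcP := conj_diracPotential ψ₁ ψ₂ z
  have hdz_congr : ∀ {g k : ℂ → ℂ}, (∀ ζ ∈ D, g ζ = k ζ) → dz g z = dz k z := by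
    intro g k hgk
    have : g =ᶠ[𝓝 z] k := Filter.eventually_of_mem (hD.mem_nhds hz) hgk
    unfold dz
    rw [this.fderiv_eq]
  have hu := contDiffOn_conj h₂
  have m₁ : dzbar (dz ψ₁) z = _ :=
    ((dzbar_dz_comm hD h₁ hz).trans (hdz_congr fun ζ hζ => (hd₁ ζ hζ).dzbar_eq)).trans
      (hP.mul (hd₂ z hz)).dz_eq
  have m₂ : dzbar (dz fun ζ => conj (ψ₂ ζ)) z = _ :=
    ((dzbar_dz_comm hD hu hz).trans (hdz_congr (k := fun ζ => -1 *
      (diracPotential ψ₁ ψ₂ ζ * conj (ψ₁ ζ))) fun ζ hζ => by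
        rw [(hd₂ ζ hζ).star.dzbar_eq, map_neg, map_mul, conj_diracPotential]
        ring)).trans ((hP.mul (hd₁ z hz).star).const_mul (-1)).dz_eq
  have w₁ := (HasW.of_differentiableAt
    (differentiableAt_of_smooth hD (contDiffOn_dz hD h₁) hz)).congr rfl m₁
  have w₂ := (HasW.of_differentiableAt
    (differentiableAt_of_smooth hD (contDiffOn_dz hD hu) hz)).congr rfl m₂
  have hB := ((((hd₁ z hz).mul w₂).sub ((hd₂ z hz).star.mul w₁)).const_mul (1 / 2)).congr_fun
    (k := abreschRosenberg ψ₁ ψ₂) (Filter.Eventually.of_forall fun ζ => by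
      simp only [abreschRosenberg]
      ring)
  have hu' := (hd₂ z hz).star.dz_eq
  rw [hB.dzbar_eq, hu']
  generalize dz (diracPotential ψ₁ ψ₂) z / (2 * diracPotential ψ₁ ψ₂ z) = p at *
  simp only [map_neg, map_mul, hcP] at hPz ⊢
  generalize diracPotential ψ₁ ψ₂ z = P at *
  linear_combination P * hPz - 2 * P * p * hPe

/-- The equation for `Q = B / P` is where holomorphy of `B` enters: `Q_z̄ = -B P_z̄ / P² = -2Q p̄`.
-/
theorem isFrameRow (hF : IsExtendedFrame D ψ₁ ψ₂ F) (hD : IsOpen D)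
    (h₁ : ContDiffOn ℝ ∞ ψ₁ D) (h₂ : ContDiffOn ℝ ∞ ψ₂ D) :
    IsFrameRow D (diracPotential ψ₁ ψ₂)
      (fun z => dz (diracPotential ψ₁ ψ₂) z / (2 * diracPotential ψ₁ ψ₂ z))
      (fun z => abreschRosenberg ψ₁ ψ₂ z / diracPotential ψ₁ ψ₂ z)
      (fun z t => F z (Circle.exp t) 0 0) (fun z t => F z (Circle.exp t) 0 1) where
  smooth_a := hF.smooth 0 0
  smooth_b := hF.smooth 0 1
  smooth_Q := ((contDiffOn_abreschRosenberg hD h₁ h₂).mul ((contDiffOn_diracPotential h₁ h₂).inv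
    fun z hz => hF.diracPotential_ne_zero hz)).congr fun z _ => div_eq_mul_inv _ _
  conj_P := conj_diracPotential ψ₁ ψ₂
  norm_eq z hz t := (entries_of_mem_SU (hF.mem_SU z hz _)).2.2.1
  hasW_P z hz := hF.hasW_diracPotential hD h₁ h₂ hz
  hasW_Q z hz := by
    have hP0 := hF.diracPotential_ne_zero hz
    have hP := hF.hasW_diracPotential hD h₁ h₂ hz
    have hB := (HasW.of_differentiableAt (differentiableAt_of_smooth hD
      (contDiffOn_abreschRosenberg hD h₁ h₂) hz)).congr rfl
      (hF.dzbar_abreschRosenberg hD h₁ h₂ hz)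
    have hQ := hB.mul (hP.inv hP0)
    refine HasW.congr hQ hQ.dz_eq.symm ?_
    field_simp
    ring
  hasW_a z hz t := (hF.hasW_entries hD h₁ h₂ hz t).1
  hasW_b z hz t := (hF.hasW_entries hD h₁ h₂ hz t).2

/-- The zeros of the holomorphic function `B` are isolated. -/
theorem abreschRosenberg_isolated_zeros (hF : IsExtendedFrame D ψ₁ ψ₂ F) (hD : IsOpen D)
    (hDc : IsPreconnected D) (h₁ : ContDiffOn ℝ ∞ ψ₁ D) (h₂ : ContDiffOn ℝ ∞ ψ₂ D)
    (hB : ∃ z ∈ D, abreschRosenberg ψ₁ ψ₂ z ≠ 0) {z : ℂ} (hz : z ∈ D) :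
    ∀ᶠ ζ in 𝓝[≠] z, abreschRosenberg ψ₁ ψ₂ ζ ≠ 0 := by
  have hd : DifferentiableOn ℂ (abreschRosenberg ψ₁ ψ₂) D := by
    intro ζ hζ
    have hW := (HasW.of_differentiableAt (differentiableAt_of_smooth hD
      (contDiffOn_abreschRosenberg hD h₁ h₂) hζ)).congr rfl
      (hF.dzbar_abreschRosenberg hD h₁ h₂ hζ)
    -- Since the `z̄`-derivative vanishes, the real derivative is multiplication by a complex
    -- number, so `B` is complex differentiable.
    have : HasFDerivAt (abreschRosenberg ψ₁ ψ₂)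
        (dz (abreschRosenberg ψ₁ ψ₂) ζ • ContinuousLinearMap.id ℂ ℂ) ζ :=
      hasFDerivAt_of_restrictScalars ℝ hW (by
        refine ContinuousLinearMap.ext fun v => ?_
        simp)
    exact this.differentiableAt.differentiableWithinAt
  have han := hd.analyticOnNhd hD
  rcases (han z hz).eventually_eq_zero_or_eventually_ne_zero with h | h
  · obtain ⟨w, hw, hw0⟩ := hB
    exact absurd (han.eqOn_zero_of_preconnected_of_eventuallyEq_zero hDc hz h hw) hw0
  · exact h

end IsExtendedFrame

/-- Needed because the Sym surface and its first-row expression are known to agree only on `D`; off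
`D` the frame is arbitrary. -/
theorem IsSingularMaximalSurface.congr {D : Set ℂ} (hD : IsOpen D) {f g : ℂ → Nil}
    (hf : IsSingularMaximalSurface D f) (h : Set.EqOn g f D) : IsSingularMaximalSurface D g := by
  have hmc : ∀ z ∈ D, ∀ v, mc g z v = mc f z v := by
    intro z hz v
    have he : g =ᶠ[𝓝 z] f := Filter.eventually_of_mem (hD.mem_nhds hz) h
    unfold mc
    rw [he.fderiv_eq, h hz]
  have hcov : ∀ z ∈ D, ∀ v, covDeriv g (fun ζ => mc g ζ v) z v =
      covDeriv f (fun ζ => mc f ζ v) z v := by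
    intro z hz v
    have he : (fun ζ => mc g ζ v) =ᶠ[𝓝 z] fun ζ => mc f ζ v :=
      Filter.eventually_of_mem (hD.mem_nhds hz) fun ζ hζ => hmc ζ hζ v
    unfold covDeriv
    rw [he.fderiv_eq, hmc z hz v]
    simp only [hmc z hz v]
  refine ⟨hf.smooth.congr h, fun z hz => ?_, fun z hz => ?_⟩
  · have := hf.conformal z hz
    simpa only [IsConformalAt, firstForm, hmc z hz] using this
  · have := hf.harmonic z hz
    unfold tension at this ⊢
    rw [hcov z hz, hcov z hz, this]

theorem mcz_congr {D : Set ℂ} (hD : IsOpen D) {f g : ℂ → Nil} (h : Set.EqOn g f D) {z : ℂ}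
    (hz : z ∈ D) : mcz g z = mcz f z := by
  have he : g =ᶠ[𝓝 z] f := Filter.eventually_of_mem (hD.mem_nhds hz) h
  unfold mcz mc
  rw [he.fderiv_eq, h hz]

/-! ### The Sym formula -/

theorem lambdaDeriv_exp (G : Circle → Matrix (Fin 2) (Fin 2) ℂ) (t : ℝ) (i j : Fin 2) :
    lambdaDeriv G (Circle.exp t) i j = -Complex.I * deriv (fun s => G (Circle.exp s) i j) t := by
  have h1 : (fun s : ℝ => G (Circle.exp t * Circle.exp s) i j) =
      fun s => (fun s => G (Circle.exp s) i j) (t + s) := by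
    funext s
    simp only [Circle.exp_add]
  simp only [lambdaDeriv, Matrix.of_apply]
  rw [h1, deriv_comp_const_add (fun s => G (Circle.exp s) i j) t 0, add_zero]

theorem deriv_conj (g : ℝ → ℂ) (t : ℝ) : deriv (fun s => conj (g s)) t = conj (deriv g t) :=
  deriv.star

theorem eq_suOfCoords {M : Matrix (Fin 2) (Fin 2) ℂ} {u v : ℂ} (hM : M = !![u, v; -conj v, -u])
    (hu : conj u = -u) : M = suOfCoords (xiNil M) := by
  have hre : u.re = 0 := by
    have := congrArg Complex.re hu
    simp at this
    linarith
  subst hM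
  ext i j
  fin_cases i <;> fin_cases j <;>
    apply Complex.ext <;> simp [suOfCoords, suBasis, Fin.sum_univ_three, xiNil, hre] <;> ring

namespace IsExtendedFrame

variable {D : Set ℂ} {ψ₁ ψ₂ : ℂ → ℂ} {F : ℂ → Circle → Matrix (Fin 2) (Fin 2) ℂ}

theorem symN_eq (hF : IsExtendedFrame D ψ₁ ψ₂ F) {z : ℂ} (hz : z ∈ D) (l : Circle) :
    symN F z l = suOfCoords ![2 * (F z l 0 0 * F z l 0 1).re, 2 * (F z l 0 0 * F z l 0 1).im,
      ‖F z l 0 0‖ ^ 2 - ‖F z l 0 1‖ ^ 2] := by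
  obtain ⟨h10, h11, -, hinv, -⟩ := entries_of_mem_SU (hF.mem_SU z hz l)
  have hFe : F z l = !![F z l 0 0, F z l 0 1; -conj (F z l 0 1), conj (F z l 0 0)] := by
    rw [← h10, ← h11]
    exact Matrix.eta_fin_two _
  unfold symN
  rw [hinv]
  conv_lhs => rw [hFe]
  simp only [← Complex.normSq_eq_norm_sq, Complex.normSq_apply]
  generalize F z l 0 0 = a
  generalize F z l 0 1 = b
  ext i j
  fin_cases i <;> fin_cases j <;>
    apply Complex.ext <;>
      simp [sigma3, suOfCoords, suBasis, Fin.sum_univ_three] <;> ring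

/-- On the circle `iλ∂_λ = ∂_t`, so up to the sign `ε` the first term of `m_±` is `∂_t F F⁻¹`. This
lies in su₂, and so does `N_m`, whence the form of the second row. -/
theorem symM_eq (hF : IsExtendedFrame D ψ₁ ψ₂ F) (hD : IsOpen D)
    (h₁ : ContDiffOn ℝ ∞ ψ₁ D) (h₂ : ContDiffOn ℝ ∞ ψ₂ D) {z : ℂ} (hz : z ∈ D) {ε : ℂ}
    (hε : conj ε = ε) (t : ℝ) :
    symM ε F z (Circle.exp t) =
      !![diagEntry ε (fun z t => F z (Circle.exp t) 0 0) (fun z t => F z (Circle.exp t) 0 1) z t,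
        offEntry ε (fun z t => F z (Circle.exp t) 0 0) (fun z t => F z (Circle.exp t) 0 1) z t;
        -conj (offEntry ε (fun z t => F z (Circle.exp t) 0 0)
          (fun z t => F z (Circle.exp t) 0 1) z t),
        -diagEntry ε (fun z t => F z (Circle.exp t) 0 0)
          (fun z t => F z (Circle.exp t) 0 1) z t] ∧
    conj (diagEntry ε (fun z t => F z (Circle.exp t) 0 0)
      (fun z t => F z (Circle.exp t) 0 1) z t) =
      -diagEntry ε (fun z t => F z (Circle.exp t) 0 0) (fun z t => F z (Circle.exp t) 0 1) z t := by
  obtain ⟨h10, h11, -, hinv, -⟩ := entries_of_mem_SU (hF.mem_SU z hz (Circle.exp t))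
  have hn := (hF.isFrameRow hD h₁ h₂).norm_deriv hD hz t
  have h22 : (starRingEnd ℂ) 2 = 2 := Complex.conj_ofNat 2
  have d10 : deriv (fun s => F z (Circle.exp s) 1 0) t =
      -conj (deriv (fun s => F z (Circle.exp s) 0 1) t) := by
    have : (fun s => F z (Circle.exp s) 1 0) = fun s => -conj (F z (Circle.exp s) 0 1) := by
      funext s
      exact (entries_of_mem_SU (hF.mem_SU z hz (Circle.exp s))).1
    rw [this, deriv.fun_neg, deriv_conj]
  have d11 : deriv (fun s => F z (Circle.exp s) 1 1) t =
      conj (deriv (fun s => F z (Circle.exp s) 0 0) t) := by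
    have : (fun s => F z (Circle.exp s) 1 1) = fun s => conj (F z (Circle.exp s) 0 0) := by
      funext s
      exact (entries_of_mem_SU (hF.mem_SU z hz (Circle.exp s))).2.1
    rw [this, deriv_conj]
  unfold diagEntry offEntry
  simp only at hn ⊢
  constructor
  · ext i j
    fin_cases i <;> fin_cases j
    all_goals
      simp [symM, symN, sigma3, hinv, lambdaDeriv_exp, Matrix.mul_apply, Fin.sum_univ_two, h10,
        h11, d10, d11, hε]
    · ring_nf
      simp only [Complex.I_sq]
      ring
    · ring_nf
      simp only [Complex.I_sq]
      ring
    · ring_nf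
      simp only [Complex.I_sq]
      ring
    · ring_nf
      simp only [Complex.I_sq]
      linear_combination ε * hn
  · simp [hε, h22]
    linear_combination ε * hn

theorem symHat_eq (hF : IsExtendedFrame D ψ₁ ψ₂ F) (hD : IsOpen D)
    (h₁ : ContDiffOn ℝ ∞ ψ₁ D) (h₂ : ContDiffOn ℝ ∞ ψ₂ D) {z : ℂ} (hz : z ∈ D) {ε : ℂ}
    (hε : conj ε = ε) (t : ℝ) :
    symHat ε F (Circle.exp t) z = suOfCoords (symSurface ε F (Circle.exp t) z) ∧
      symSurface ε F (Circle.exp t) z = rowSurface ε (fun z t => F z (Circle.exp t) 0 0)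
        (fun z t => F z (Circle.exp t) 0 1) t z := by
  have hm := fun s => hF.symM_eq hD h₁ h₂ hz hε s
  simp only [symSurface, rowSurface]
  generalize offEntry ε (fun z t => F z (Circle.exp t) 0 0)
    (fun z t => F z (Circle.exp t) 0 1) z = v at *
  generalize diagEntry ε (fun z t => F z (Circle.exp t) 0 0)
    (fun z t => F z (Circle.exp t) 0 1) z = u at *
  have hu : conj (deriv u t) = -deriv u t := by
    rw [← deriv_conj, ← deriv.fun_neg]
    congr 1
    funext s
    exact (hm s).2
  have d0 : lambdaDeriv (symM ε F z) (Circle.exp t) 0 0 = -Complex.I * deriv u t := by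
    rw [lambdaDeriv_exp]
    simp [fun s => (hm s).1]
  have d1 : lambdaDeriv (symM ε F z) (Circle.exp t) 1 1 = Complex.I * deriv u t := by
    rw [lambdaDeriv_exp]
    simp [fun s => (hm s).1]
  have hS : symHat ε F (Circle.exp t) z =
      !![ε / 2 * deriv u t, v t; -conj (v t), -(ε / 2 * deriv u t)] := by
    unfold symHat symExpr
    rw [(hm t).1]
    ext i j
    fin_cases i <;> fin_cases j <;> simp [offPart, diagPart, d0, d1] <;>
      first
      | linear_combination ε / 2 * deriv u t * Complex.I_sq
      | linear_combination -(ε / 2 * deriv u t * Complex.I_sq)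
  have h22 : (starRingEnd ℂ) 2 = 2 := Complex.conj_ofNat 2
  refine ⟨eq_suOfCoords hS (by rw [map_mul, map_div₀, hε, h22, hu]; ring), ?_⟩
  rw [hS]
  ext k
  fin_cases k
  · simp [xiNil]
    ring
  · simp [xiNil]
    ring
  · change (-2 * Complex.I * (ε / 2 * deriv u t)).re = (-Complex.I * ε * deriv u t).re
    congr 1
    ring

end IsExtendedFrame

/-- Negating `m` reverses the off-diagonal part, while in the diagonal part it compensates the
change of the sign `ε`. -/
theorem xiNil_symExpr_neg (m : Circle → Matrix (Fin 2) (Fin 2) ℂ) (l : Circle) :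
    xiNil (symExpr (-1) (fun l' => -m l') l) = halfTurn (xiNil (symExpr 1 m l)) := by
  ext k
  fin_cases k <;> simp [xiNil, symExpr, halfTurn, offPart, diagPart, lambdaDeriv, deriv.fun_neg] <;>
    ring

/-! ### Wronskians of the first row, which relate the two surfaces by duality -/

namespace IsFrameRow

variable {D : Set ℂ} {P p Q : ℂ → ℂ} {a b : ℂ → ℝ → ℂ}

/-- The `p`-terms cancel and `|a|² + |b|² = 1` leaves a pure `Q`-term. Multiplied by `-2` it is the
coefficient of `f_+`, just as the Wronskian of `b` and `ā` yields that of `f_-`. -/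
theorem wronskian_ab (h : IsFrameRow D P p Q a b) {z : ℂ} (hz : z ∈ D) (t : ℝ) :
    a z t * dz (fun ζ => conj (b ζ t)) z - conj (b z t) * dz (fun ζ => a ζ t) z =
      -(conj (circ t) * Q z) := by
  rw [(h.hasW_b z hz t).star.dz_eq, (h.hasW_a z hz t).dz_eq]
  simp
  linear_combination -conj (circ t) * Q z * h.norm_eq z hz t

theorem wronskian_ba (h : IsFrameRow D P p Q a b) {z : ℂ} (hz : z ∈ D) (t : ℝ) :
    b z t * dz (fun ζ => conj (a ζ t)) z - conj (a z t) * dz (fun ζ => b ζ t) z =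
      conj (circ t) * P z := by
  rw [(h.hasW_a z hz t).star.dz_eq, (h.hasW_b z hz t).dz_eq]
  simp [h.conj_P z]
  linear_combination conj (circ t) * P z * h.norm_eq z hz t

end IsFrameRow

/-! ### Singular points, Gauss map, duality and the value at `λ = 1` of the Sym surfaces -/

namespace IsExtendedFrame

variable {D : Set ℂ} {ψ₁ ψ₂ : ℂ → ℂ} {F : ℂ → Circle → Matrix (Fin 2) (Fin 2) ℂ}

/-- The spinor representation of the surfaces given by the Sym formula. -/
theorem symSurface_spec (hF : IsExtendedFrame D ψ₁ ψ₂ F) (hD : IsOpen D)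
    (h₁ : ContDiffOn ℝ ∞ ψ₁ D) (h₂ : ContDiffOn ℝ ∞ ψ₂ D) (l : Circle) :
    IsSingularMaximalSurface D (symSurface (-1) F l) ∧
    IsSingularMaximalSurface D (symSurface 1 F l) ∧
    (∀ z ∈ D, mcz (symSurface (-1) F l) z =
      (-2 * diracPotential ψ₁ ψ₂ z * conj (l : ℂ)) • spinorVec (F z l 0 0) (F z l 0 1)) ∧
    (∀ z ∈ D, mcz (symSurface 1 F l) z =
      (2 * (abreschRosenberg ψ₁ ψ₂ z / diracPotential ψ₁ ψ₂ z) * conj (l : ℂ)) •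
        spinorVec (F z l 0 1) (F z l 0 0)) := by
  obtain ⟨t, rfl⟩ : ∃ t, Circle.exp t = l := ⟨_, Circle.exp_arg l⟩
  have R := hF.isFrameRow hD h₁ h₂
  have hm : Set.EqOn (symSurface (-1) F (Circle.exp t)) _ D := fun z hz =>
    (hF.symHat_eq hD h₁ h₂ hz (by simp) t).2
  have hp : Set.EqOn (symSurface 1 F (Circle.exp t)) _ D := fun z hz =>
    (hF.symHat_eq hD h₁ h₂ hz (by simp) t).2
  exact ⟨(R.isSingularMaximalSurface_neg hD t).congr hD hm,
    (R.isSingularMaximalSurface_one hD t).congr hD hp,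
    fun z hz => (mcz_congr hD hm hz).trans (R.mcz_rowSurface_neg hD hz t),
    fun z hz => (mcz_congr hD hp hz).trans (R.mcz_rowSurface_one hD hz t)⟩

theorem contDiffOn_entry (hF : IsExtendedFrame D ψ₁ ψ₂ F) (l : Circle) (i j : Fin 2) :
    ContDiffOn ℝ ∞ (fun z => F z l i j) D := by
  obtain ⟨t, rfl⟩ : ∃ t, Circle.exp t = l := ⟨_, Circle.exp_arg l⟩
  exact (hF.smooth i j).comp (contDiff_prodMk_left t).contDiffOn fun z hz => ⟨hz, trivial⟩

theorem norm_sq_add (hF : IsExtendedFrame D ψ₁ ψ₂ F) {z : ℂ} (hz : z ∈ D) (l : Circle) :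
    ‖F z l 0 0‖ ^ 2 + ‖F z l 0 1‖ ^ 2 = 1 := by
  have h := (entries_of_mem_SU (hF.mem_SU z hz l)).2.2.1
  rw [Complex.mul_conj', Complex.mul_conj'] at h
  exact_mod_cast h

theorem potential_factor_ne_zero (hF : IsExtendedFrame D ψ₁ ψ₂ F) {z : ℂ} (hz : z ∈ D)
    (l : Circle) : -2 * diracPotential ψ₁ ψ₂ z * conj (l : ℂ) ≠ 0 :=
  mul_ne_zero (mul_ne_zero (by norm_num) (hF.diracPotential_ne_zero hz))
    ((map_ne_zero _).2 l.coe_ne_zero)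

/-- Stated for any `f` with the Maurer-Cartan form of `f_-`, so that at `λ = 1` it applies to the
original surface as well. -/
theorem isDualSurface_of_mcz (hF : IsExtendedFrame D ψ₁ ψ₂ F) (hD : IsOpen D)
    (h₁ : ContDiffOn ℝ ∞ ψ₁ D) (h₂ : ContDiffOn ℝ ∞ ψ₂ D) (l : Circle) {f : ℂ → Nil}
    (hf : ∀ z ∈ D, mcz f z = mcz (symSurface (-1) F l) z) :
    IsDualSurface D f (symSurface 1 F l) := by
  obtain ⟨-, -, hm, hp⟩ := hF.symSurface_spec hD h₁ h₂ l
  refine isDualSurface_of_spinors hD (x := fun z => F z l 0 0) (y := fun z => F z l 0 1)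
    ((contDiffOn_const.mul (contDiffOn_diracPotential h₁ h₂)).mul contDiffOn_const)
    (hF.contDiffOn_entry l 0 0) (hF.contDiffOn_entry l 0 1)
    (fun z hz => hF.potential_factor_ne_zero hz l) (fun z hz => hF.norm_sq_add hz l)
    (fun z hz => (hf z hz).trans (hm z hz)) fun z hz => ?_
  obtain ⟨t, rfl⟩ : ∃ t, Circle.exp t = l := ⟨_, Circle.exp_arg l⟩
  rw [hp z hz, (hF.isFrameRow hD h₁ h₂).wronskian_ab hz t]
  congr 1
  simp only [circ]
  ring

/-- The zeros of `B` are removed because there the coefficient `2Qλ̄` of `f_+` vanishes, whereas the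
duality criterion requires a nonzero coefficient, with a local smooth root. -/
theorem isDualSurface_symSurface_one (hF : IsExtendedFrame D ψ₁ ψ₂ F) (hD : IsOpen D)
    (h₁ : ContDiffOn ℝ ∞ ψ₁ D) (h₂ : ContDiffOn ℝ ∞ ψ₂ D) (l : Circle) :
    IsDualSurface {z | z ∈ D ∧ abreschRosenberg ψ₁ ψ₂ z ≠ 0}
      (symSurface 1 F l) (symSurface (-1) F l) := by
  obtain ⟨-, -, hm, hp⟩ := hF.symSurface_spec hD h₁ h₂ l
  have hS : {z | z ∈ D ∧ abreschRosenberg ψ₁ ψ₂ z ≠ 0} ⊆ D := fun z hz => hz.1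
  have hO : IsOpen {z | z ∈ D ∧ abreschRosenberg ψ₁ ψ₂ z ≠ 0} :=
    (contDiffOn_abreschRosenberg hD h₁ h₂).continuousOn.isOpen_inter_preimage hD
      isOpen_compl_singleton
  have R := hF.isFrameRow hD h₁ h₂
  refine isDualSurface_of_spinors hO (x := fun z => F z l 0 1) (y := fun z => F z l 0 0)
    (((contDiffOn_const.mul R.smooth_Q).mul contDiffOn_const).mono hS)
    ((hF.contDiffOn_entry l 0 1).mono hS) ((hF.contDiffOn_entry l 0 0).mono hS)
    (fun z hz => mul_ne_zero (mul_ne_zero two_ne_zero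
      (div_ne_zero hz.2 (hF.diracPotential_ne_zero hz.1))) ((map_ne_zero _).2 l.coe_ne_zero))
    (fun z hz => by rw [add_comm]; exact hF.norm_sq_add hz.1 l)
    (fun z hz => hp z hz.1) fun z hz => ?_
  obtain ⟨t, rfl⟩ : ∃ t, Circle.exp t = l := ⟨_, Circle.exp_arg l⟩
  rw [hm z hz.1, R.wronskian_ba hz.1 t]
  congr 1
  simp only [circ]
  ring

theorem isSpacelikeAt_neg_iff (hF : IsExtendedFrame D ψ₁ ψ₂ F) (hD : IsOpen D)
    (h₁ : ContDiffOn ℝ ∞ ψ₁ D) (h₂ : ContDiffOn ℝ ∞ ψ₂ D) (l : Circle) {z : ℂ} (hz : z ∈ D) :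
    IsSpacelikeAt (symSurface (-1) F l) z ↔ z ∈ regularSet D F l := by
  rw [isSpacelikeAt_iff_of_spinors ((hF.symSurface_spec hD h₁ h₂ l).2.2.1 z hz)]
  exact ⟨fun h => ⟨hz, h.2⟩, fun h => ⟨hF.potential_factor_ne_zero hz l, h.2⟩⟩

theorem isSpacelikeAt_one_iff (hF : IsExtendedFrame D ψ₁ ψ₂ F) (hD : IsOpen D)
    (h₁ : ContDiffOn ℝ ∞ ψ₁ D) (h₂ : ContDiffOn ℝ ∞ ψ₂ D) (l : Circle) {z : ℂ} (hz : z ∈ D) :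
    IsSpacelikeAt (symSurface 1 F l) z ↔
      z ∈ regularSet D F l ∧ abreschRosenberg ψ₁ ψ₂ z ≠ 0 := by
  rw [isSpacelikeAt_iff_of_spinors ((hF.symSurface_spec hD h₁ h₂ l).2.2.2 z hz)]
  constructor
  · rintro ⟨h, h'⟩
    refine ⟨⟨hz, h'.symm⟩, fun h0 => h ?_⟩
    simp [h0]
  · rintro ⟨⟨-, h⟩, h'⟩
    exact ⟨mul_ne_zero (mul_ne_zero two_ne_zero (div_ne_zero h' (hF.diracPotential_ne_zero hz)))
      ((map_ne_zero _).2 l.coe_ne_zero), h.symm⟩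

theorem isNormalGaussMap (hF : IsExtendedFrame D ψ₁ ψ₂ F) {l : Circle} {Ω : Set ℂ}
    (hΩ : Ω ⊆ regularSet D F l) {f : ℂ → Nil} {c : ℂ → ℂ}
    (hf : ∀ z ∈ Ω, mcz f z = c z • spinorVec (F z l 0 0) (F z l 0 1) ∨
      mcz f z = c z • spinorVec (F z l 0 1) (F z l 0 0)) :
    IsNormalGaussMap Ω f (fun z => spinorNormal (F z l 0 0) (F z l 0 1))
      (fun z => symN F z l) where
  smooth := contDiffOn_spinorNormal
    ((hF.contDiffOn_entry l 0 0).mono fun _ hz => (hΩ hz).1)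
    ((hF.contDiffOn_entry l 0 1).mono fun _ hz => (hΩ hz).1) fun _ hz => (hΩ hz).2
  normal z hz := ⟨lip_spinorNormal (hF.norm_sq_add (hΩ hz).1 l) (hΩ hz).2,
    lip_mc_spinorNormal (hF.norm_sq_add (hΩ hz).1 l) (hf z hz)⟩
  sphere z hz := by
    refine ⟨_, hF.symN_eq (hΩ hz).1 l, ?_, sphereProj_eq_hypProj (hΩ hz).2⟩
    have h1 := hF.norm_sq_add (hΩ hz).1 l
    simp only [Matrix.cons_val, ← Complex.normSq_eq_norm_sq, Complex.normSq_apply] at h1 ⊢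
    generalize F z l 0 0 = a at *
    generalize F z l 0 1 = b at *
    simp only [Complex.mul_re, Complex.mul_im]
    linear_combination (a.re * a.re + a.im * a.im + (b.re * b.re + b.im * b.im) + 1) * h1

/-- The frame at `λ = 1` consists of the spinors divided by the real number `r`, and `-2P = r²`;
quadratic homogeneity of `spinorVec` cancels the two. -/
theorem mcz_symSurface_at_one (hF : IsExtendedFrame D ψ₁ ψ₂ F) (hD : IsOpen D)
    {f : ℂ → Nil} (hψ : IsGeneratingSpinors D f ψ₁ ψ₂) {z : ℂ} (hz : z ∈ D) :
    mcz (symSurface (-1) F 1) z = mcz f z := by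
  rw [(hF.symSurface_spec hD hψ.smooth₁ hψ.smooth₂ 1).2.2.1 z hz, hψ.mcz_eq z hz,
    hF.at_one z hz, diracPotential_eq, Complex.mul_conj', Complex.mul_conj']
  simp only [Matrix.smul_apply, Matrix.of_apply, Matrix.cons_val, smul_eq_mul]
  have hs := Real.sq_sqrt (hF.spinors_norm_pos hz).le
  have hr : (((Real.sqrt (‖ψ₁ z‖ ^ 2 + ‖ψ₂ z‖ ^ 2) : ℝ) : ℂ)) ≠ 0 :=
    Complex.ofReal_ne_zero.2 (Real.sqrt_pos.2 (hF.spinors_norm_pos hz)).ne'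
  have hs' : (‖ψ₁ z‖ : ℂ) ^ 2 + (‖ψ₂ z‖ : ℂ) ^ 2 =
      ((Real.sqrt (‖ψ₁ z‖ ^ 2 + ‖ψ₂ z‖ ^ 2) : ℝ) : ℂ) ^ 2 := by exact_mod_cast hs.symm
  rw [hs']
  have hc : conj (((Real.sqrt (‖ψ₁ z‖ ^ 2 + ‖ψ₂ z‖ ^ 2) : ℝ) : ℂ))⁻¹ =
      (((Real.sqrt (‖ψ₁ z‖ ^ 2 + ‖ψ₂ z‖ ^ 2) : ℝ) : ℂ))⁻¹ := by
    rw [map_inv₀, Complex.conj_ofReal]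
  have key := spinorVec_mul_conj_mul
    (((Real.sqrt (‖ψ₁ z‖ ^ 2 + ‖ψ₂ z‖ ^ 2) : ℝ) : ℂ))⁻¹ (ψ₁ z) (ψ₂ z)
  rw [hc] at key
  rw [key, smul_smul]
  generalize ((Real.sqrt (‖ψ₁ z‖ ^ 2 + ‖ψ₂ z‖ ^ 2) : ℝ) : ℂ) = r at *
  have : -2 * (-(1 / 2) * r ^ 2) * conj ((1 : Circle) : ℂ) * r⁻¹ ^ 2 = 1 := by
    simp
    field_simp
  rw [this, one_smul]

end IsExtendedFrame

end NilSurface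

end

theorem mainTheorem2 (D : Set ℂ) (hD : IsOpen D) (hDc : IsConnected D)
    (f : ℂ → Nil) (hf : IsMaximalSurface D f)
    (ψ₁ ψ₂ : ℂ → ℂ) (hψ : IsGeneratingSpinors D f ψ₁ ψ₂)
    (hB : ∃ z ∈ D, abreschRosenberg ψ₁ ψ₂ z ≠ 0)
    (F : ℂ → Circle → Matrix (Fin 2) (Fin 2) ℂ) (hF : IsExtendedFrame D ψ₁ ψ₂ F) :
    -- the zeros of `B` are isolated
    (∀ z ∈ D, abreschRosenberg ψ₁ ψ₂ z = 0 →
      ∀ᶠ ζ in 𝓝[≠] z, abreschRosenberg ψ₁ ψ₂ ζ ≠ 0) ∧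
    (∀ l : Circle,
      -- the Sym formula takes values in `su₂`
      (∀ z ∈ D, symHat (-1) F l z = suOfCoords (symSurface (-1) F l z) ∧
        symHat 1 F l z = suOfCoords (symSurface 1 F l z)) ∧
      -- `f_±^λ` are maximal surfaces, with the following singular points
      IsSingularMaximalSurface D (symSurface (-1) F l) ∧
      IsSingularMaximalSurface D (symSurface 1 F l) ∧
      (∀ z ∈ D, IsSpacelikeAt (symSurface (-1) F l) z ↔ z ∈ regularSet D F l) ∧
      (∀ z ∈ D, IsSpacelikeAt (symSurface 1 F l) z ↔
        z ∈ regularSet D F l ∧ abreschRosenberg ψ₁ ψ₂ z ≠ 0) ∧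
      IsMaximalSurface (regularSet D F l) (symSurface (-1) F l) ∧
      IsMaximalSurface {z | z ∈ regularSet D F l ∧ abreschRosenberg ψ₁ ψ₂ z ≠ 0}
        (symSurface 1 F l) ∧
      -- `N_m` is the normal Gauss map of both, for the same left-translated unit normal
      (∃ n : ℂ → Nil,
        IsNormalGaussMap (regularSet D F l) (symSurface (-1) F l) n (fun z => symN F z l) ∧
        IsNormalGaussMap {z | z ∈ regularSet D F l ∧ abreschRosenberg ψ₁ ψ₂ z ≠ 0}
          (symSurface 1 F l) n (fun z => symN F z l)) ∧
      -- `f_-^λ` and `f_+^λ` are dual to each other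
      IsDualSurface D (symSurface (-1) F l) (symSurface 1 F l) ∧
      IsDualSurface {z | z ∈ D ∧ abreschRosenberg ψ₁ ψ₂ z ≠ 0}
        (symSurface 1 F l) (symSurface (-1) F l) ∧
      -- with the sign `-i/2`, the loop `-m_+` gives `f_+^λ` up to a rigid motion
      (∀ z ∈ D, xiNil (symExpr (-1) (fun l' => -symM 1 F z l') l) =
        halfTurn (symSurface 1 F l z))) ∧
    -- at `λ = 1`, `f_-` is `f` up to a left translation, and `f_+` is the dual of `f`
    regularSet D F 1 = D ∧
    (∃ p : Nil, ∀ z ∈ D, symSurface (-1) F 1 z = nilMul p (f z)) ∧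
    IsDualSurface D f (symSurface 1 F 1) := by
  have h₁ := hψ.smooth₁
  have h₂ := hψ.smooth₂
  have hone : ∀ z ∈ D, mcz f z = mcz (symSurface (-1) F 1) z := fun z hz =>
    (hF.mcz_symSurface_at_one hD hψ hz).symm
  refine ⟨fun z hz _ => hF.abreschRosenberg_isolated_zeros hD hDc.isPreconnected h₁ h₂ hB hz,
    fun l => ?_, ?_, ?_, hF.isDualSurface_of_mcz hD h₁ h₂ 1 hone⟩
  · obtain ⟨sm, sp, hm, hp⟩ := hF.symSurface_spec hD h₁ h₂ l
    refine ⟨fun z hz => ?_, sm, sp, fun z hz => hF.isSpacelikeAt_neg_iff hD h₁ h₂ l hz,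
      fun z hz => hF.isSpacelikeAt_one_iff hD h₁ h₂ l hz,
      sm.isMaximalSurface (fun z hz => hz.1)
        fun z hz => (hF.isSpacelikeAt_neg_iff hD h₁ h₂ l hz.1).2 hz,
      sp.isMaximalSurface (fun z hz => hz.1.1)
        fun z hz => (hF.isSpacelikeAt_one_iff hD h₁ h₂ l hz.1.1).2 hz,
      ⟨_, hF.isNormalGaussMap subset_rfl fun z hz => Or.inl (hm z hz.1),
        hF.isNormalGaussMap (fun z hz => hz.1) fun z hz => Or.inr (hp z hz.1.1)⟩,
      hF.isDualSurface_of_mcz hD h₁ h₂ l fun z _ => rfl,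
      hF.isDualSurface_symSurface_one hD h₁ h₂ l,
      fun z _ => xiNil_symExpr_neg (symM 1 F z) l⟩
    obtain ⟨t, rfl⟩ : ∃ t, Circle.exp t = l := ⟨_, Circle.exp_arg l⟩
    exact ⟨(hF.symHat_eq hD h₁ h₂ hz (by simp) t).1, (hF.symHat_eq hD h₁ h₂ hz (by simp) t).1⟩
  -- At `λ = 1` the surface `f_-` has the induced metric of `f`, which is Riemannian, so the
  -- criterion for non-singular points holds on all of `D`.
  · refine Set.Subset.antisymm (fun z hz => hz.1) fun z hz => ?_
    have hs := hf.spacelike z hz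
    rw [← hF.isSpacelikeAt_neg_iff hD h₁ h₂ 1 hz]
    intro v hv
    unfold firstForm
    rw [← mc_eq_of_mcz_eq (hone z hz)]
    exact hs v hv
  · exact exists_nilMul_of_mcz_eq hD hDc
      (fun z hz => differentiableAt_of_smooth hD hf.smooth hz)
      (fun z hz => differentiableAt_of_smooth hD
        (hF.symSurface_spec hD h₁ h₂ 1).1.smooth hz) fun z hz => (hone z hz).symm
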